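/- For integers $d\ge 2$ and $r\ge 3$, an instance of Max-$(d,r)$-CSP consists of $n$ variables with values in $[d]=\{1,\dots,d\}$ and a finite list of $m$ constraints. Each constraint consists of a sequence of $\ell\le r$ variables together with a relation $R\subseteq[d]^{\ell}$ (given by its truth table), and is satisfied by an assignment if the values assigned to its variables form a tuple in $R$. The task is to compute the minimum number of constraints that must be deleted so that some assignment satisfies all the remaining ones (constraints are counted with multiplicity). An instance of Max $3$-Sat is a CNF formula with $n$ variables and $m$ clauses, each with at most three literals; the task is to compute the minimum number of clauses that must be deleted to make the formula satisfiable. Algorithms are deterministic multi-tape Turing machines, and "time $b^n\cdot n^{O(1)}$" means at most $C\, b^{n}(n+m+1)^{k}$ steps on every instance, for some constants $C,k$ independent of the instance. The Max $3$-Sat Hypothesis states that there is no $\varepsilon>0$ such that every instance of Max $3$-Sat can be solved in time $(2-\varepsilon)^n\cdot n^{O(1)}$. **Theorem.** Assume the Max $3$-Sat Hypothesis. Then for all integers $d\ge 2$ and $r\ge 3$ there is no $\varepsilon>0$ such that some algorithm solves every instance of Max-$(d,r)$-CSP in time $(d-\varepsilon)^n\cdot n^{O(1)}$. -/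

import Mathlib

/-! ### Encodings over the alphabet `{true, false}` -/

/-- Self-delimiting unary code of a natural number: `k` times `true`, then `false`. -/
def encodeUnary (k : ℕ) : List Bool := List.replicate k true ++ [false]

/-- Self-delimiting code of a list: every entry is announced by `true`, the end by `false`. -/
def encodeListWith {α : Type} (e : α → List Bool) (l : List α) : List Bool :=
  l.flatMap (fun a => true :: e a) ++ [false]

/-! ### Constraint deletion -/

/-- The smallest number of members of the list `cs` of constraints that have to be deleted so that
some assignment `a : A` satisfies all remaining ones. Deleted constraints are given by their
positions, so constraints that occur repeatedly in `cs` are counted with multiplicity. -/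
noncomputable def minDeletions {A K : Type} (sat : A → K → Prop) (cs : List K) : ℕ :=
  sInf {k : ℕ | ∃ S : Finset (Fin cs.length), S.card = k ∧
    ∃ a : A, ∀ i : Fin cs.length, i ∉ S → sat a (cs.get i)}

/-! ### Max 3-Sat -/

/-- A clause with at most three literals over the variables `Fin n`. The literal `(v, true)` is the
variable `v`, and `(v, false)` is its negation. -/
structure ThreeClause (n : ℕ) where
  lits : List (Fin n × Bool)
  length_le : lits.length ≤ 3

/-- The valuation `a` makes at least one literal of the clause true. -/
def ThreeClause.Sat {n : ℕ} (a : Fin n → Bool) (c : ThreeClause n) : Prop :=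
  ∃ l ∈ c.lits, a l.1 = l.2

/-- A CNF formula with at most three literals in each clause. -/
structure ThreeCNF where
  numVars : ℕ
  clauses : List (ThreeClause numVars)

namespace ThreeCNF

/-- The minimum number of clauses whose deletion makes the formula satisfiable. -/
noncomputable def opt (φ : ThreeCNF) : ℕ :=
  minDeletions (A := Fin φ.numVars → Bool) ThreeClause.Sat φ.clauses

/-- The number of variables, followed by the list of clauses, each one a list of literals. -/
def encode (φ : ThreeCNF) : List Bool :=
  encodeUnary φ.numVars ++
    encodeListWith (fun c : ThreeClause φ.numVars =>
      encodeListWith (fun l : Fin φ.numVars × Bool => encodeUnary l.1 ++ [l.2]) c.lits) φ.clauses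

end ThreeCNF

/-! ### Max-CSP -/

/-- A constraint of arity at most `r` on variables `Fin n` with values in the domain `Fin d`: a
sequence of `arity` variables (possibly with repetitions) and a relation `rel ⊆ [d] ^ arity`. -/
structure CSPConstraint (d r n : ℕ) where
  arity : ℕ
  arity_le : arity ≤ r
  scope : Fin arity → Fin n
  rel : Finset (Fin arity → Fin d)

/-- The images of the variables of the constraint under `a` form a tuple of its relation. -/
def CSPConstraint.Sat {d r n : ℕ} (a : Fin n → Fin d) (c : CSPConstraint d r n) : Prop :=
  (fun i => a (c.scope i)) ∈ c.rel

/-- The list of variables in the scope, followed by the truth table of the relation. -/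
def CSPConstraint.encode {d r n : ℕ} (c : CSPConstraint d r n) : List Bool :=
  encodeListWith (fun v : Fin n => encodeUnary v) (List.ofFn c.scope) ++
    List.ofFn (fun i : Fin (d ^ c.arity) => decide (finFunctionFinEquiv.symm i ∈ c.rel))

/-- An instance of `(d, r)`-CSP. -/
structure CSPInstance (d r : ℕ) where
  numVars : ℕ
  constraints : List (CSPConstraint d r numVars)

namespace CSPInstance

variable {d r : ℕ}

/-- The minimum number of constraints whose deletion makes the instance satisfiable. -/
noncomputable def opt (I : CSPInstance d r) : ℕ :=
  minDeletions (A := Fin I.numVars → Fin d) CSPConstraint.Sat I.constraints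

/-- The number of variables, followed by the list of constraints. -/
def encode (I : CSPInstance d r) : List Bool :=
  encodeUnary I.numVars ++ encodeListWith CSPConstraint.encode I.constraints

end CSPInstance

/-! ### Algorithms and running times -/

/-- Some deterministic Turing machine (with finitely many stacks, all over finite alphabets, finitely
many labels and internal states), started on the code of any instance `x`, halts with the number
`f x` as its output after at most `C * b ^ n * (n + m + 1) ^ k` steps, where `n = nVars x` and
`m = nCons x`, for constants `C` and `k` that do not depend on `x`.

This is the running time `b ^ n * (n + m) ^ O(1)`. For the instances considered here the length of
the code and the output are bounded by polynomials in `n` and `m`. -/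
def SolvableInTime {α : Type} (code : α → List Bool) (nVars nCons : α → ℕ) (f : α → ℕ) (b : ℝ) :
    Prop :=
  ∃ M : Turing.TM2ComputableAux Bool Bool, (∀ s : M.tm.K, Finite (M.tm.Γ s)) ∧
    ∃ C k : ℕ, ∀ x : α, ∃ t : ℕ,
      (t : ℝ) ≤ (C : ℝ) * b ^ nVars x * ((nVars x : ℝ) + (nCons x : ℝ) + 1) ^ k ∧
      Nonempty (Turing.TM2OutputsInTime M.tm
        ((code x).map M.inputAlphabet.symm)
        (some ((encodeUnary (f x)).map M.outputAlphabet.symm)) t)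

/-- Every instance of Max 3-Sat with `n` variables and `m` clauses can be solved in time
`b ^ n * (n + m) ^ O(1)`. -/
def MaxThreeSatSolvable (b : ℝ) : Prop :=
  SolvableInTime ThreeCNF.encode (fun φ => φ.numVars) (fun φ => φ.clauses.length) ThreeCNF.opt b

/-- Every instance of Max-`(d, r)`-CSP with `n` variables and `m` constraints can be solved in time
`b ^ n * (n + m) ^ O(1)`. -/
def MaxCSPSolvable (d r : ℕ) (b : ℝ) : Prop :=
  SolvableInTime (CSPInstance.encode (d := d) (r := r)) (fun I => I.numVars)
    (fun I => I.constraints.length) CSPInstance.opt b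

/-- The Max 3-Sat Hypothesis. -/
def MaxThreeSatHypothesis : Prop :=
  ¬ ∃ ε : ℝ, 0 < ε ∧ MaxThreeSatSolvable (2 - ε)

/-! Cut the `n` variables of a formula into `n / q + 1` groups of at most `q` consecutive ones. A
valuation of a group is a vertex of the cube of dimension `q`, read as a number below `2 ^ q`, and
`K` blocks of `d` consecutive numbers cover the cube once `2 ^ q ≤ K * d`. After a block has been
fixed for every group, a group is one variable with `d` values, and a clause is a constraint of
arity at most three. Assignments of such a restricted instance decode to valuations that satisfy the
corresponding clauses (`sat_restrictClause`), and every valuation arises from some choice of blocks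
(`exists_decode_eq`). So the optimum of the formula is the minimum of the restricted optima
(`minUpTo_opt_restrict`).

There are `K ^ (n / q + 1)` choices. If each costs `b ^ (n / q + 1)` with `b = d - δ`, the total is
about `(K * b) ^ (n / q)`. For `K = ⌊2 ^ q / d⌋ + 1` the product `K * b` is at most `2 ^ q - 2 ^ q *
δ / d + d - δ`: the gain from `δ` grows with `q`, the loss from rounding stays below `d`. For large
`q` the basis `(K * b) ^ (1 / q)` is therefore less than 2.

The rest realises this reduction by a Turing machine. The given CSP machine becomes a subroutine
(`stepAux_embed`, `run_machine`); it can be reused because halting leaves it in its initial state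
with only the output on its stacks. What depends on `d`, `q`, `K` alone sits in the finite control.
Each loop of `prog` has a lemma with explicit start, end and step bound; `computation` chains them
and `total_time_le` does the arithmetic. -/

open Turing TM2

/-! ### Reachability with a bound on the number of steps -/

/-- Iterating the partial function `f` at most `t` times leads from `a` to `b`. -/
def ReachesIn {α : Type} (f : α → Option α) (t : ℕ) (a b : α) : Prop :=
  ∃ s ≤ t, (flip bind f)^[s] (some a) = some b

namespace ReachesIn

variable {α : Type} {f : α → Option α}

theorem refl (a : α) : ReachesIn f 0 a a := ⟨0, le_rfl, rfl⟩

theorem mono {t t' : ℕ} {a b : α} (h : ReachesIn f t a b) (ht : t ≤ t') : ReachesIn f t' a b :=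
  let ⟨s, hs, e⟩ := h
  ⟨s, hs.trans ht, e⟩

theorem trans {t u : ℕ} {a b c : α} (h : ReachesIn f t a b) (h' : ReachesIn f u b c) :
    ReachesIn f (t + u) a c := by
  obtain ⟨s, hs, e⟩ := h
  obtain ⟨s', hs', e'⟩ := h'
  refine ⟨s' + s, by omega, ?_⟩
  rw [Function.iterate_add_apply, e, e']

theorem head {t : ℕ} {a b c : α} (h : f a = some b) (h' : ReachesIn f t b c) :
    ReachesIn f (t + 1) a c := by
  obtain ⟨s, hs, e⟩ := h'
  refine ⟨s + 1, by omega, ?_⟩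
  rw [Function.iterate_succ_apply]
  change (flip bind f)^[s] (f a) = _
  rw [h, e]

theorem single {a b : α} (h : f a = some b) : ReachesIn f 1 a b := head h (refl b)

theorem iterate_bind_none (s : ℕ) : (flip bind f)^[s] none = none := by
  induction s with
  | zero => rfl
  | succ s ih => rw [Function.iterate_succ_apply]; exact ih

/-- A map that carries steps of `f` to steps of `g` carries runs of `f` to runs of `g`. -/
theorem map {β : Type} {g : β → Option β} (e : α → β)
    (he : ∀ a b, f a = some b → g (e a) = some (e b)) {t : ℕ} {a b : α} (h : ReachesIn f t a b) :
    ReachesIn g t (e a) (e b) := by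
  obtain ⟨s, hs, h⟩ := h
  refine mono ?_ hs
  clear hs t
  induction s generalizing a with
  | zero => cases h; exact refl _
  | succ s ih =>
    rw [Function.iterate_succ_apply] at h
    change (flip bind f)^[s] (f a) = _ at h
    cases hf : f a with
    | none => rw [hf, iterate_bind_none] at h; cases h
    | some c => rw [hf] at h; exact head (he _ _ hf) (ih h)

end ReachesIn

/-! ### Statement combinators -/

namespace Turing.TM2.Stmt

variable {S : Type} {Γ : S → Type} {Λ Λ' σ σ' Y : Type}

/-- Continue with `f y`, where `y` is the current value of `g`. -/
def branchOn [DecidableEq Y] (l : List Y) (g : σ → Y) (f : Y → Stmt Γ Λ σ) : Stmt Γ Λ σ :=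
  l.foldr (fun y q => branch (fun s => decide (g s = y)) (f y) q) halt

theorem stepAux_branchOn [DecidableEq S] [DecidableEq Y] {l : List Y} {g : σ → Y}
    (f : Y → Stmt Γ Λ σ) {v : σ} (T : ∀ k, List (Γ k)) (h : g v ∈ l) :
    stepAux (branchOn l g f) v T = stepAux (f (g v)) v T := by
  induction l with
  | nil => simp at h
  | cons y l ih =>
    by_cases hy : g v = y
    · simp [branchOn, hy]
    · have := ih (by simpa [hy] using h)
      simpa [branchOn, hy] using this

/-- Push the entries of `l`, one after the other. -/
def pushList (k : S) (l : List (Γ k)) (q : Stmt Γ Λ σ) : Stmt Γ Λ σ :=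
  l.foldr (fun x q => push k (fun _ => x) q) q

theorem stepAux_pushList [DecidableEq S] (k : S) (l : List (Γ k)) (q : Stmt Γ Λ σ) (v : σ)
    (T : ∀ k, List (Γ k)) :
    stepAux (pushList k l q) v T = stepAux q v (Function.update T k (l.reverse ++ T k)) := by
  induction l generalizing T with
  | nil => simp [pushList]
  | cons x l ih =>
    have := ih (Function.update T k (x :: T k))
    simpa [pushList] using this

/-- Pop an element of the stack `k` and continue depending on it. The second component of the
internal state is only used to pass the element on. -/
noncomputable def popCase [DecidableEq Y] [Fintype Y] (k : S) (e : Γ k → Y)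
    (f : Option Y → Stmt Γ Λ (σ × Option Y)) : Stmt Γ Λ (σ × Option Y) :=
  pop k (fun s x => (s.1, x.map e))
    (branchOn Finset.univ.toList Prod.snd fun y => load (fun s => (s.1, none)) (f y))

/-- The scratch component of the state is `none` before and after, so configurations between
statements need not mention it. -/
theorem stepAux_popCase [DecidableEq S] [DecidableEq Y] [Fintype Y] (k : S) (e : Γ k → Y)
    (f : Option Y → Stmt Γ Λ (σ × Option Y)) (v : σ) (T : ∀ k, List (Γ k)) :
    stepAux (popCase k e f) (v, none) T =
      stepAux (f ((T k).head?.map e)) (v, none) (Function.update T k (T k).tail) := by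
  rw [popCase, stepAux, stepAux_branchOn _ _ (by simp)]
  rfl

end Turing.TM2.Stmt

/-! ### Machines as parts of machines -/

namespace Turing.TM2

variable {S S' : Type} {Γ : S → Type} {Γ' : S' → Type} {Λ Λ' σ σ' : Type}

/-- The contents of two families of stacks. -/
def joinStk (T : ∀ k, List (Γ k)) (T' : ∀ k, List (Γ' k)) : ∀ k, List (Sum.elim Γ Γ' k)
  | Sum.inl k => T k
  | Sum.inr k => T' k

theorem update_joinStk_inl [DecidableEq S] [DecidableEq S'] (T : ∀ k, List (Γ k))
    (T' : ∀ k, List (Γ' k)) (k : S) (x : List (Γ k)) :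
    Function.update (joinStk T T') (Sum.inl k) x = joinStk (Function.update T k x) T' := by
  funext k'
  rcases k' with k' | k'
  · by_cases h : k' = k
    · subst h
      exact (Function.update_self _ _ _).trans (Function.update_self k' x T).symm
    · change _ = Function.update T k x k'
      rw [Function.update_of_ne h]
      exact Function.update_of_ne (by simpa using h) _ _
  · exact Function.update_of_ne (by simp) _ _

theorem update_joinStk_inr [DecidableEq S] [DecidableEq S'] (T : ∀ k, List (Γ k))
    (T' : ∀ k, List (Γ' k)) (k : S') (x : List (Γ' k)) :
    Function.update (joinStk T T') (Sum.inr k) x = joinStk T (Function.update T' k x) := by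
  funext k'
  rcases k' with k' | k'
  · exact Function.update_of_ne (by simp) _ _
  · by_cases h : k' = k
    · subst h
      exact (Function.update_self _ _ _).trans (Function.update_self k' x T').symm
    · change _ = Function.update T' k x k'
      rw [Function.update_of_ne h]
      exact Function.update_of_ne (by simpa using h) _ _

/-- The statement `q` of a machine as a statement of a machine that has further stacks, labels and
internal states, and continues at the label `l` where `q` halts. -/
def Stmt.embed (l : Λ') : Stmt Γ Λ σ → Stmt (Sum.elim Γ Γ') (Λ ⊕ Λ') (σ × σ')
  | push k f q => push (Sum.inl k) (fun s => f s.1) (embed l q)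
  | peek k f q => peek (Sum.inl k) (fun s x => (f s.1 x, s.2)) (embed l q)
  | pop k f q => pop (Sum.inl k) (fun s x => (f s.1 x, s.2)) (embed l q)
  | load f q => load (fun s => (f s.1, s.2)) (embed l q)
  | branch f q₁ q₂ => branch (fun s => f s.1) (embed l q₁) (embed l q₂)
  | goto f => goto (fun s => Sum.inl (f s.1))
  | halt => goto (fun _ => Sum.inr l)

/-- The configuration of the larger machine that corresponds to one of the smaller machine. -/
def Cfg.embed (l : Λ') (w : σ') (T' : ∀ k, List (Γ' k)) (c : Cfg Γ Λ σ) :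
    Cfg (Sum.elim Γ Γ') (Λ ⊕ Λ') (σ × σ') :=
  ⟨some (c.l.elim (Sum.inr l) Sum.inl), (c.var, w), joinStk c.stk T'⟩

/-- The simulation lemma: embedded statements touch neither the added stacks nor the added state. A
halting configuration corresponds to one at the return label `l`. -/
theorem stepAux_embed [DecidableEq S] [DecidableEq S'] (l : Λ') (w : σ') (T' : ∀ k, List (Γ' k))
    (q : Stmt Γ Λ σ) (v : σ) (T : ∀ k, List (Γ k)) :
    stepAux (q.embed l) (v, w) (joinStk T T') = (stepAux q v T).embed l w T' := by
  induction q generalizing v T with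
  | push k f q ih =>
    exact (congrArg _ (update_joinStk_inl T T' k (f v :: T k))).trans (ih _ _)
  | peek k f q ih => exact ih _ _
  | pop k f q ih =>
    exact (congrArg _ (update_joinStk_inl T T' k (T k).tail)).trans (ih _ _)
  | load f q ih => exact ih _ _
  | branch f q₁ q₂ ih₁ ih₂ =>
    change cond (f v) _ _ = Cfg.embed l w T' (cond (f v) _ _)
    cases f v
    · exact ih₂ _ _
    · exact ih₁ _ _
  | goto f => rfl
  | halt => rfl

end Turing.TM2

/-! ### The machine -/

namespace MinMachine

section Defs

variable (d q K : ℕ) [NeZero q] [NeZero K]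

/-- A literal seen in its group of `q` variables: the position in the group, the part of the cube
to which the group is restricted, and the sign. -/
abbrev Lit : Type := Fin q × Fin K × Bool

/-- At most three literals. -/
abbrev Lits : Type := {l : List (Lit q K) // l.length ≤ 3}

/-- Append a literal, if there is room. -/
def Lits.snoc {q K : ℕ} (L : Lits q K) (x : Lit q K) : Lits q K :=
  if h : L.1.length < 3 then ⟨L.1 ++ [x], by simpa using h⟩ else L

/-- The value `a` of a group satisfies the literal. -/
def Lit.Holds {q K : ℕ} (d : ℕ) (x : Lit q K) (a : ℕ) : Prop :=
  (x.2.1 * d + a).testBit x.1 = x.2.2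

/-- The truth table of the disjunction of `k` literals. -/
noncomputable def tableFn {q K : ℕ} (d : ℕ) {k : ℕ} (L : Fin k → Lit q K) : List Bool :=
  open Classical in
  List.ofFn fun i : Fin (d ^ k) =>
    decide (∃ t, (L t).Holds d (finFunctionFinEquiv.symm i t : Fin d))

/-- The truth table of the disjunction of a list of literals. -/
noncomputable def table {q K : ℕ} (d : ℕ) (L : List (Lit q K)) : List Bool :=
  tableFn d L.get

/-- The stacks of the machine in addition to those of the given machine. -/
inductive Stack
  | inp | bak | out | best | tmp | ctr | aux
  deriving DecidableEq

/-- The alphabets of the additional stacks. -/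
abbrev Alph : Stack → Type
  | .ctr | .aux => Fin K
  | _ => Bool

/-- The labels of the machine in addition to those of the given machine. -/
inductive Label
  | size (j : Fin q)
  | bound
  | restore
  | read (mode : Option (Lits q K)) (j : Fin q)
  | emit (mode : Option (Lits q K))
  | clause
  | literal (L : Lits q K)
  | flip
  | compare
  | clear
  | move
  | incr
  | zeros
  | wipe
  | wipeAux
  | answer

end Defs

/-- The contents of the additional stacks. -/
structure Mem (K : ℕ) where
  inp : List Bool
  bak : List Bool
  out : List Bool
  best : List Bool
  tmp : List Bool
  ctr : List (Fin K)
  aux : List (Fin K)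

/-- The contents of the additional stacks as a family. -/
def Mem.stk {K : ℕ} (s : Mem K) : ∀ k, List (Alph K k)
  | .inp => s.inp
  | .bak => s.bak
  | .out => s.out
  | .best => s.best
  | .tmp => s.tmp
  | .ctr => s.ctr
  | .aux => s.aux

/-- Replace the contents of one stack. -/
def Mem.set {K : ℕ} (s : Mem K) : ∀ k, List (Alph K k) → Mem K
  | .inp, x => { s with inp := x }
  | .bak, x => { s with bak := x }
  | .out, x => { s with out := x }
  | .best, x => { s with best := x }
  | .tmp, x => { s with tmp := x }
  | .ctr, x => { s with ctr := x }
  | .aux, x => { s with aux := x }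

theorem Mem.update_stk {K : ℕ} (s : Mem K) (k : Stack) (x : List (Alph K k)) :
    Function.update s.stk k x = (s.set k x).stk := by
  funext k'
  by_cases h : k' = k
  · subst h
    rw [Function.update_self]
    cases k' <;> rfl
  · rw [Function.update_of_ne h]
    cases k <;> cases k' <;> first | rfl | exact absurd rfl h

section Program

variable (M : TM2ComputableAux Bool Bool) (d q K : ℕ) [NeZero q] [NeZero K]

/-- The statements of the machine. -/
abbrev Prog : Type :=
  Stmt (Sum.elim M.tm.Γ (Alph K)) (M.tm.Λ ⊕ Label q K) (M.tm.σ × Option (Bool ⊕ Fin K))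

variable {M q K}

/-- Go to a label. -/
def jump (l : Label q K) : Prog M q K := .goto fun _ => Sum.inr l

/-- Push a fixed element. -/
def put (k : Stack) (x : Alph K k) (p : Prog M q K) : Prog M q K :=
  .push (Sum.inr k) (fun _ => x) p

/-- Push a fixed list of elements. -/
def putList (k : Stack) (x : List (Alph K k)) (p : Prog M q K) : Prog M q K :=
  .pushList (Sum.inr k) x p

/-- Pop a bit. -/
noncomputable def getBit (k : Stack) (e : Alph K k → Bool) (f : Option Bool → Prog M q K) :
    Prog M q K :=
  .popCase (Sum.inr k) (fun x => Sum.inl (e x)) fun y => f (y.bind Sum.getLeft?)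

/-- Pop a digit. -/
noncomputable def getDigit (k : Stack) (e : Alph K k → Fin K) (f : Option (Fin K) → Prog M q K) :
    Prog M q K :=
  .popCase (Sum.inr k) (fun x => Sum.inr (e x)) fun y => f (y.bind Sum.getRight?)

variable (M q K)

/-- The machine. On the stack `ctr` it enumerates all restrictions of the groups of variables to
parts of the cube. For each of them it writes the code of the restricted instance to the input stack
of `M`, runs `M` and replaces the number on the stack `best` by the output if this is smaller. -/
noncomputable def prog : M.tm.Λ ⊕ Label q K → Prog M q K
  | .inl l => (M.tm.m l).embed .compare
  | .inr (.size j) => getBit .inp id fun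
    | some true => put .bak true <|
      if h : j.1 + 1 < q then jump (.size ⟨j.1 + 1, h⟩) else put .ctr (0 : Fin K) (jump (.size 0))
    | some false => put .bak false <| put .ctr (0 : Fin K) (jump .bound)
    | none => .halt
  | .inr .bound => getBit .inp id fun
    | some b => put .bak b <| put .best true (jump .bound)
    | none => jump .restore
  | .inr .restore => getBit .bak id fun
    | some b => put .inp b (jump .restore)
    | none => put .out true (jump (.read none 0))
  | .inr (.read mode j) => getBit .inp id fun
    | some true => put .bak true <|
      if h : j.1 + 1 < q then jump (.read mode ⟨j.1 + 1, h⟩) else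
        getDigit .ctr id fun
          | some x => put .aux x (jump (.read mode 0))
          | none => .halt
    | some false => put .bak false <| match mode with
      | none => jump (.emit none)
      | some L => getBit .inp id fun
        | some b => put .bak b <| getDigit .ctr id fun
          | some x => put .ctr x (jump (.emit (some (L.snoc (j, x, b)))))
          | none => .halt
        | none => .halt
    | none => .halt
  | .inr (.emit mode) => getDigit .aux id fun
    | some x => put .ctr x <| put .out true (jump (.emit mode))
    | none => put .out false <| match mode with
      | none => jump .clause
      | some L => jump (.literal L)
  | .inr .clause => getBit .inp id fun
    | some true => put .bak true <| put .out true (jump (.literal ⟨[], by simp⟩))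
    | some false => put .bak false <| put .out false (jump .flip)
    | none => .halt
  | .inr (.literal L) => getBit .inp id fun
    | some true => put .bak true <| put .out true (jump (.read (some L) 0))
    | some false => put .bak false <| put .out false <| putList .out (table d L.1) (jump .clause)
    | none => .halt
  | .inr .flip => getBit .out id fun
    | some b => .push (Sum.inl M.tm.k₀) (fun _ => M.inputAlphabet.symm b) (jump .flip)
    | none => .goto fun _ => Sum.inl M.tm.main
  | .inr .compare =>
    .popCase (Sum.inl M.tm.k₁) (fun x => Sum.inl (M.outputAlphabet x)) fun
      | some (Sum.inl true) => getBit .best id fun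
        | some _ => put .tmp true (jump .compare)
        | none => jump .compare
      | _ => jump .clear
  | .inr .clear => getBit .best id fun
    | some _ => jump .clear
    | none => jump .move
  | .inr .move => getBit .tmp id fun
    | some b => put .best b (jump .move)
    | none => jump .incr
  | .inr .incr => getDigit .ctr id fun
    | some x => if h : x.1 + 1 < K then put .ctr (⟨x.1 + 1, h⟩ : Fin K) (jump .zeros) else
        put .aux (0 : Fin K) (jump .incr)
    | none => jump .wipe
  | .inr .zeros => getDigit .aux id fun
    | some x => put .ctr x (jump .zeros)
    | none => jump .restore
  | .inr .wipe => getBit .bak id fun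
    | some _ => jump .wipe
    | none => jump .wipeAux
  | .inr .wipeAux => getDigit .aux id fun
    | some _ => jump .wipeAux
    | none => put .tmp false (jump .answer)
  | .inr .answer => getBit .best id fun
    | some b => put .tmp b (jump .answer)
    | none => .halt

end Program

section Exec

variable {M : TM2ComputableAux Bool Bool} {q K : ℕ}

/-- Execute a statement when the stacks of `M` hold `T`, and the others `s`. -/
def exec (T : ∀ k, List (M.tm.Γ k)) (p : Prog M q K) (s : Mem K) :
    Cfg (Sum.elim M.tm.Γ (Alph K)) (M.tm.Λ ⊕ Label q K) (M.tm.σ × Option (Bool ⊕ Fin K)) :=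
  stepAux p (M.tm.initialState, none) (joinStk T s.stk)

/-- The configuration at label `l` when the stacks of `M` hold `T`, and the others `s`. -/
def conf (T : ∀ k, List (M.tm.Γ k)) (l : Label q K) (s : Mem K) :
    Cfg (Sum.elim M.tm.Γ (Alph K)) (M.tm.Λ ⊕ Label q K) (M.tm.σ × Option (Bool ⊕ Fin K)) :=
  ⟨some (Sum.inr l), (M.tm.initialState, none), joinStk T s.stk⟩

variable (T : ∀ k, List (M.tm.Γ k)) (s : Mem K) (p : Prog M q K)

@[simp]
theorem step_conf [NeZero q] [NeZero K] (d : ℕ) (l : Label q K) :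
    step (prog M d q K) (conf T l s) = some (exec T (prog M d q K (.inr l)) s) := rfl

@[simp]
theorem exec_jump (l : Label q K) : exec T (jump l : Prog M q K) s = conf T l s := rfl

theorem update_joinStk_stk (k : Stack) (x : List (Alph K k)) :
    Function.update (joinStk T s.stk) (Sum.inr k) x = joinStk T (s.set k x).stk := by
  rw [← Mem.update_stk]
  exact update_joinStk_inr T s.stk k x

@[simp]
theorem exec_put (k : Stack) (x : Alph K k) :
    exec T (put k x p) s = exec T p (s.set k (x :: s.stk k)) :=
  congrArg (stepAux p _) (update_joinStk_stk T s k _)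

@[simp]
theorem exec_putList (k : Stack) (x : List (Alph K k)) :
    exec T (putList k x p) s = exec T p (s.set k (x.reverse ++ s.stk k)) :=
  (Stmt.stepAux_pushList _ _ _ _ _).trans (congrArg (stepAux p _) (update_joinStk_stk T s k _))

@[simp]
theorem exec_getBit (k : Stack) (e : Alph K k → Bool) (f : Option Bool → Prog M q K) :
    exec T (getBit k e f) s = exec T (f ((s.stk k).head?.map e)) (s.set k (s.stk k).tail) := by
  refine (Stmt.stepAux_popCase _ _ _ _ _).trans ?_
  rw [exec, ← update_joinStk_stk]
  change stepAux (f (((s.stk k).head?.map _).bind _)) _ _ = _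
  congr 2
  cases (s.stk k).head? <;> rfl

@[simp]
theorem exec_getDigit (k : Stack) (e : Alph K k → Fin K) (f : Option (Fin K) → Prog M q K) :
    exec T (getDigit k e f) s = exec T (f ((s.stk k).head?.map e)) (s.set k (s.stk k).tail) := by
  refine (Stmt.stepAux_popCase _ _ _ _ _).trans ?_
  rw [exec, ← update_joinStk_stk]
  change stepAux (f (((s.stk k).head?.map _).bind _)) _ _ = _
  congr 2
  cases (s.stk k).head? <;> rfl

@[simp]
theorem exec_push_inl (k : M.tm.K) (x : M.tm.Γ k) :
    exec T (.push (Sum.inl k) (fun _ => x) p) s = exec (Function.update T k (x :: T k)) p s :=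
  congrArg (stepAux p _) (update_joinStk_inl T s.stk k _)

@[simp]
theorem exec_popCase_inl (k : M.tm.K) (e : M.tm.Γ k → Bool ⊕ Fin K)
    (f : Option (Bool ⊕ Fin K) → Prog M q K) :
    exec T (.popCase (Sum.inl k) e f) s =
      exec (Function.update T k (T k).tail) (f ((T k).head?.map e)) s :=
  (Stmt.stepAux_popCase _ _ _ _ _).trans
    (congrArg (stepAux _ _) (update_joinStk_inl T s.stk k _))

end Exec

attribute [simp] prog Mem.set Mem.stk

end MinMachine

/-! ### Recursive form of the codes -/

theorem encodeUnary_zero : encodeUnary 0 = [false] := rfl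

theorem encodeUnary_succ (k : ℕ) : encodeUnary (k + 1) = true :: encodeUnary k := rfl

@[simp]
theorem length_encodeUnary (k : ℕ) : (encodeUnary k).length = k + 1 := by simp [encodeUnary]

theorem encodeListWith_nil {α : Type} (e : α → List Bool) : encodeListWith e [] = [false] := rfl

theorem encodeListWith_cons {α : Type} (e : α → List Bool) (x : α) (l : List α) :
    encodeListWith e (x :: l) = true :: (e x ++ encodeListWith e l) := by
  simp [encodeListWith]

/-! ### Reading unary numbers with division by `q` -/

namespace MinMachine

section Loops

variable {M : TM2ComputableAux Bool Bool} {d q K : ℕ} [NeZero q] [NeZero K]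
  {T : ∀ k, List (M.tm.Γ k)} (i b o e t : List Bool) (c a : List (Fin K))

/-- The label counts modulo `q`; every wrap-around and the final `false` push a zero digit. From `j
= 0` the counter gets one digit per group. -/
theorem size_loop (v : ℕ) (j : Fin q) :
    ReachesIn (step (prog M d q K)) (v + 1) (conf T (.size j) ⟨encodeUnary v ++ i, b, o, e, t, c, a⟩)
      (conf T .bound ⟨i, (encodeUnary v).reverse ++ b, o, e, t,
        List.replicate ((j + v) / q + 1) 0 ++ c, a⟩) := by
  induction v generalizing j b c with
  | zero =>
    refine .single ?_
    simp [encodeUnary_zero, Nat.div_eq_of_lt j.2]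
  | succ v ih =>
    by_cases h : j.1 + 1 < q
    · refine .head (b := conf T (.size ⟨j.1 + 1, h⟩)
        ⟨encodeUnary v ++ i, true :: b, o, e, t, c, a⟩) ?_ ?_
      · simp [encodeUnary_succ, h]
      · convert ih (true :: b) c ⟨j.1 + 1, h⟩ using 3
        · simp [encodeUnary_succ]
        · rw [add_assoc, add_comm 1]
    · refine .head (b := conf T (.size 0)
        ⟨encodeUnary v ++ i, true :: b, o, e, t, 0 :: c, a⟩) ?_ ?_
      · simp [encodeUnary_succ, h]
      · convert ih (true :: b) (0 :: c) 0 using 3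
        · simp [encodeUnary_succ]
        · have : j.1 + (v + 1) = v + q := by omega
          rw [this, Nat.add_div_right _ (NeZero.pos q), List.replicate_succ']
          simp

/-- Initialises the running minimum: the length of the code of the clauses is an upper bound for the
optimum that needs no computation. -/
theorem bound_loop (w : List Bool) :
    ReachesIn (step (prog M d q K)) (w.length + 1) (conf T .bound ⟨w, b, o, e, t, c, a⟩)
      (conf T .restore ⟨[], w.reverse ++ b, o, List.replicate w.length true ++ e, t, c, a⟩) := by
  induction w generalizing b e with
  | nil => exact .single (by simp)
  | cons x w ih =>
    refine .head (b := conf T .bound ⟨w, x :: b, o, true :: e, t, c, a⟩) (by simp) ?_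
    convert ih (x :: b) (true :: e) using 3 <;> simp [List.replicate_succ']

theorem restore_loop (w : List Bool) :
    ReachesIn (step (prog M d q K)) (w.length + 1) (conf T .restore ⟨i, w, o, e, t, c, a⟩)
      (conf T (.read none 0) ⟨w.reverse ++ i, [], true :: o, e, t, c, a⟩) := by
  induction w generalizing i with
  | nil => exact .single (by simp)
  | cons x w ih =>
    refine .head (b := conf T .restore ⟨x :: i, w, o, e, t, c, a⟩) (by simp) ?_
    convert ih (x :: i) using 3 <;> simp

/-- Division with remainder: the label holds the remainder, and each wrap-around moves a digit from
`ctr` to `aux`. Afterwards the length of the moved part is the quotient, and the digit of the group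
reached, if there is one, is on top of `ctr`. -/
theorem read_loop (mode : Option (Lits q K)) (v : ℕ) (j : Fin q) (h : (j + v) / q ≤ c.length) :
    ReachesIn (step (prog M d q K)) v
      (conf T (.read mode j) ⟨List.replicate v true ++ i, b, o, e, t, c, a⟩)
      (conf T (.read mode ⟨(j + v) % q, Nat.mod_lt _ (NeZero.pos q)⟩)
        ⟨i, List.replicate v true ++ b, o, e, t,
        c.drop ((j + v) / q), (c.take ((j + v) / q)).reverse ++ a⟩) := by
  induction v generalizing j b c a with
  | zero =>
    simp [Nat.div_eq_of_lt j.2, Nat.mod_eq_of_lt j.2]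
    exact .refl _
  | succ v ih =>
    by_cases hj : j.1 + 1 < q
    · refine .head (b := conf T (.read mode ⟨j.1 + 1, hj⟩)
        ⟨List.replicate v true ++ i, true :: b, o, e, t, c, a⟩) ?_ ?_
      · simp [List.replicate_succ, hj]
      · have hv : j.1 + (v + 1) = j.1 + 1 + v := by omega
        rw [hv] at h ⊢
        convert ih (true :: b) c a ⟨j.1 + 1, hj⟩ h using 3
        simp [List.replicate_succ']
    · have hv : j.1 + (v + 1) = v + q := by omega
      rw [hv, Nat.add_div_right _ (NeZero.pos q)] at h ⊢
      obtain _ | ⟨x, c⟩ := c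
      · simp at h
      refine .head (b := conf T (.read mode 0)
        ⟨List.replicate v true ++ i, true :: b, o, e, t, c, x :: a⟩) ?_ ?_
      · simp [List.replicate_succ, hj]
      · convert ih (true :: b) c (x :: a) 0 (by simpa using h) using 3
        · simp
        · simp [List.replicate_succ']
        · simp
        · simp

/-- Moving the digits back restores the counter and at the same time writes the quotient in unary.
-/
theorem emit_loop (mode : Option (Lits q K)) (w : List (Fin K)) :
    ReachesIn (step (prog M d q K)) (w.length + 1) (conf T (.emit mode) ⟨i, b, o, e, t, c, w⟩)
      (conf T (mode.elim .clause .literal)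
        ⟨i, b, (encodeUnary w.length).reverse ++ o, e, t, w.reverse ++ c, []⟩) := by
  induction w generalizing o c with
  | nil => cases mode <;> exact .single (by simp [encodeUnary_zero])
  | cons x w ih =>
    refine .head (b := conf T (.emit mode) ⟨i, b, true :: o, e, t, x :: c, w⟩) (by simp) ?_
    convert ih (true :: o) (x :: c) using 3 <;> simp [encodeUnary_succ]

theorem read_number (n : ℕ) (h : n / q ≤ c.length) :
    ReachesIn (step (prog M d q K)) (2 * (encodeUnary n).length)
      (conf T (.read none 0) ⟨encodeUnary n ++ i, b, o, e, t, c, []⟩)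
      (conf T .clause ⟨i, (encodeUnary n).reverse ++ b, (encodeUnary (n / q)).reverse ++ o, e, t,
        c, []⟩) := by
  have h₁ := read_loop (M := M) (d := d) (T := T) (false :: i) b o e t c [] none n (0 : Fin q)
    (by simpa using h)
  have h₂ := emit_loop (M := M) (d := d) (q := q) (T := T) i (false :: (List.replicate n true ++ b))
    o e t (c.drop (n / q)) none (c.take (n / q)).reverse
  simp only [Fin.val_zero, zero_add, List.append_nil] at h₁
  simp only [List.length_reverse, List.length_take, min_eq_left h, List.reverse_reverse,
    List.take_append_drop] at h₂
  have := Nat.div_le_self n q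
  refine .mono (t := n + (n / q + 1 + 1)) ?_ (by simp; omega)
  convert h₁.trans (.head ?_ h₂) using 2
  all_goals simp [encodeUnary]

/-- The inequality is strict, unlike in `read_number`, since the digit of group `v / q` itself has
to be inspected. -/
theorem read_literal (L : Lits q K) (v : ℕ) (s : Bool) (h : v / q < c.length) :
    ReachesIn (step (prog M d q K)) (2 * (encodeUnary v ++ [s]).length)
      (conf T (.read (some L) 0) ⟨encodeUnary v ++ s :: i, b, o, e, t, c, []⟩)
      (conf T (.literal (L.snoc (⟨v % q, Nat.mod_lt _ (NeZero.pos q)⟩, c.getD (v / q) 0, s)))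
        ⟨i, (encodeUnary v ++ [s]).reverse ++ b, (encodeUnary (v / q)).reverse ++ o, e, t,
          c, []⟩) := by
  have h₁ := read_loop (M := M) (d := d) (T := T) (false :: s :: i) b o e t c [] (some L) v
    (0 : Fin q) (by simpa using h.le)
  have h₂ := emit_loop (M := M) (d := d) (q := q) (T := T) i
    (s :: false :: (List.replicate v true ++ b)) o e t (c.drop (v / q))
    (some (L.snoc (⟨v % q, Nat.mod_lt _ (NeZero.pos q)⟩, c.getD (v / q) 0, s)))
    (c.take (v / q)).reverse
  simp only [Fin.val_zero, zero_add, List.append_nil] at h₁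
  simp only [List.length_reverse, List.length_take, min_eq_left h.le, List.reverse_reverse,
    List.take_append_drop] at h₂
  have := Nat.div_le_self v q
  refine .mono (t := v + (v / q + 1 + 1)) ?_ (by simp; omega)
  convert h₁.trans (.head ?_ h₂) using 2
  all_goals simp [encodeUnary, h]

end Loops

end MinMachine

/-! ### The restricted instances and the translation of clauses -/

namespace MinMachine

section Restrict

variable {d q K r n : ℕ} [NeZero q] [NeZero K]

/-- The literal `(v, s)` seen in the group of its variable, where the groups are restricted to the
parts of the cube listed in `c`. -/
def toLit (c : List (Fin K)) (l : Fin n × Bool) : Lit q K :=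
  (⟨l.1 % q, Nat.mod_lt _ (NeZero.pos q)⟩, c.getD (l.1 / q) 0, l.2)

/-- The constraint on the groups of variables that expresses a clause. -/
noncomputable def restrictClause (d q : ℕ) [NeZero q] (hr : 3 ≤ r) (c : List (Fin K))
    (C : ThreeClause n) : CSPConstraint d r (n / q + 1) where
  arity := C.lits.length
  arity_le := C.length_le.trans hr
  scope i := ⟨(C.lits.get i).1 / q, Nat.lt_succ_of_le (Nat.div_le_div_right (C.lits.get i).1.2.le)⟩
  rel := open Classical in
    Finset.univ.filter fun a => ∃ i, (toLit (q := q) c (C.lits.get i)).Holds d (a i)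

/-- The instance on the groups of variables that results from a formula when the groups are
restricted to the parts of the cube listed in `c`. -/
noncomputable def restrict (d q : ℕ) [NeZero q] (hr : 3 ≤ r) (c : List (Fin K)) (φ : ThreeCNF) :
    CSPInstance d r where
  numVars := φ.numVars / q + 1
  constraints := φ.clauses.map (restrictClause d q hr c)

omit [NeZero q] [NeZero K] in
theorem table_map {α : Type} (d : ℕ) (g : α → Lit q K) (l : List α) :
    table d (l.map g) = tableFn d fun i => g (l.get i) := by
  -- The two tables are indexed by powers whose exponents are only propositionally equal; for a
  -- general `L` the length equation can be eliminated.
  have key : ∀ (L : List (Lit q K)) (h : L.length = l.length) (f : Fin l.length → Lit q K),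
      (∀ i, L.get i = f (i.cast h)) → table d L = tableFn d f := by
    intro L h f hf
    obtain rfl : f = fun i => L.get (i.cast h.symm) := by
      funext i
      rw [hf]
      rfl
    clear hf
    revert h
    generalize l.length = k
    rintro rfl
    rfl
  exact key _ (by simp) _ fun i => by simp

theorem mem_rel_restrictClause (hr : 3 ≤ r) (c : List (Fin K)) (C : ThreeClause n)
    (a : Fin C.lits.length → Fin d) : a ∈ (restrictClause d q hr c C).rel ↔
      ∃ i, (toLit (q := q) c (C.lits.get i)).Holds d (a i) := by
  classical
  exact Finset.mem_filter.trans (and_iff_right (Finset.mem_univ _))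

theorem encode_restrictClause (hr : 3 ≤ r) (c : List (Fin K)) (C : ThreeClause n) :
    (restrictClause d q hr c C).encode =
      encodeListWith (fun l => encodeUnary (l.1 / q)) C.lits ++
        table d (C.lits.map (toLit (q := q) c)) := by
  rw [CSPConstraint.encode, table_map]
  congr 1
  · have : C.lits = List.ofFn C.lits.get := (List.ofFn_get _).symm
    conv_rhs => rw [this]
    simp only [encodeListWith, List.flatMap_def, List.map_ofFn]
    rfl
  · exact congrArg List.ofFn (funext fun i => decide_eq_decide.2 (mem_rel_restrictClause hr c C _))

end Restrict

section Loops

variable {M : TM2ComputableAux Bool Bool} {d q K : ℕ} [NeZero q] [NeZero K]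
  {T : ∀ k, List (M.tm.Γ k)} (i b o e t : List Bool) (c a : List (Fin K))

/-- The code of a literal. -/
def encodeLiteral {n : ℕ} (l : Fin n × Bool) : List Bool := encodeUnary l.1 ++ [l.2]

/-- The group indices are written at once, while the literals are collected in the label and
determine the table written at the end. By `hL`, `Lits.snoc` never drops a literal. -/
theorem literal_loop {n : ℕ} (L : Lits q K) (ls : List (Fin n × Bool)) (hc : n / q < c.length)
    (hL : L.1.length + ls.length ≤ 3) :
    ReachesIn (step (prog M d q K)) (2 * (encodeListWith encodeLiteral ls).length)
      (conf T (.literal L) ⟨encodeListWith encodeLiteral ls ++ i, b, o, e, t, c, []⟩)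
      (conf T .clause ⟨i, (encodeListWith encodeLiteral ls).reverse ++ b,
        (encodeListWith (fun l => encodeUnary (l.1 / q)) ls ++
          table d (L.1 ++ ls.map (toLit c))).reverse ++ o, e, t, c, []⟩) := by
  induction ls generalizing L b o with
  | nil =>
    refine (ReachesIn.single ?_).mono (by simp [encodeListWith_nil])
    simp [encodeListWith_nil]
  | cons l ls ih =>
    have hl : l.1.1 / q < c.length := (Nat.div_le_div_right l.1.2.le).trans_lt hc
    have h₁ := read_literal (M := M) (d := d) (T := T)
      (encodeListWith encodeLiteral ls ++ i) (true :: b) (true :: o) e t c L l.1 l.2 hl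
    have hs : (L.snoc (toLit c l)).1 = L.1 ++ [toLit c l] := by
      have : L.1.length < 3 := by simp at hL; omega
      simp [Lits.snoc, this]
    have h₂ := ih ((encodeUnary l.1 ++ [l.2]).reverse ++ true :: b)
      ((encodeUnary (l.1 / q)).reverse ++ true :: o) (L.snoc (toLit c l)) (by
        rw [hs]
        simp at hL ⊢
        omega)
    rw [hs, List.append_assoc L.1] at h₂
    refine .mono (t := 2 * (encodeUnary l.1.1 ++ [l.2]).length + 1 +
      2 * (encodeListWith encodeLiteral ls).length) ?_ (by
        simp [encodeListWith_cons, encodeLiteral]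
        omega)
    convert (ReachesIn.head ?_ h₁).trans h₂ using 2
    all_goals simp [encodeListWith_cons, encodeLiteral]

/-- The code of a clause. -/
def encodeClause {n : ℕ} (C : ThreeClause n) : List Bool := encodeListWith encodeLiteral C.lits

theorem clause_loop {r n : ℕ} (hr : 3 ≤ r) (Cs : List (ThreeClause n)) (hc : n / q < c.length) :
    ReachesIn (step (prog M d q K)) (2 * (encodeListWith encodeClause Cs).length)
      (conf T .clause ⟨encodeListWith encodeClause Cs ++ i, b, o, e, t, c, []⟩)
      (conf T .flip ⟨i, (encodeListWith encodeClause Cs).reverse ++ b,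
        (encodeListWith CSPConstraint.encode
          (Cs.map (restrictClause d q hr c))).reverse ++ o, e, t, c, []⟩) := by
  induction Cs generalizing b o with
  | nil =>
    refine (ReachesIn.single ?_).mono (by simp [encodeListWith_nil])
    simp [encodeListWith_nil]
  | cons C Cs ih =>
    have h₁ := literal_loop (M := M) (d := d) (q := q) (T := T)
      (encodeListWith encodeClause Cs ++ i) (true :: b) (true :: o) e t c ⟨[], by simp⟩ C.lits hc
      (by simpa using C.length_le)
    have h₂ := ih ((encodeClause C).reverse ++ true :: b)
      ((restrictClause d q hr c C).encode.reverse ++ true :: o)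
    rw [List.nil_append, ← encode_restrictClause hr] at h₁
    refine .mono (t := 2 * (encodeClause C).length + 1 +
      2 * (encodeListWith encodeClause Cs).length) ?_ (by
        simp [encodeListWith_cons]
        omega)
    convert (ReachesIn.head ?_ h₁).trans h₂ using 2
    all_goals simp [encodeListWith_cons, encodeClause]

end Loops

end MinMachine

/-! ### Running `M`, updating the minimum, counting in base `K` -/

namespace MinMachine

theorem dite_eq_update (tm : FinTM2) (k₀ : tm.K) (w : List (tm.Γ k₀)) :
    (fun k => @dite (List (tm.Γ k)) (k = k₀) (tm.kDecidableEq k k₀)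
      (fun h => by rw [h]; exact w) fun _ => []) = Function.update (fun _ => []) k₀ w := by
  funext k
  by_cases h : k = k₀
  · subst h
    rw [Function.update_self, dif_pos rfl]
    rfl
  · rw [Function.update_of_ne h, dif_neg h]

section Loops

variable {M : TM2ComputableAux Bool Bool} {d q K : ℕ} [NeZero q] [NeZero K]
  {T : ∀ k, List (M.tm.Γ k)} (i b o e t : List Bool) (c a : List (Fin K))

/-- The stacks of `M`, all empty except for one. -/
def only (M : TM2ComputableAux Bool Bool) (k : M.tm.K) (w : List (M.tm.Γ k)) :
    ∀ k, List (M.tm.Γ k) :=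
  Function.update (fun _ => []) k w

@[simp]
theorem only_self (k : M.tm.K) (w : List (M.tm.Γ k)) : only M k w k = w :=
  Function.update_self (β := fun k => List (M.tm.Γ k)) k w _

@[simp]
theorem update_only (k : M.tm.K) (w w' : List (M.tm.Γ k)) :
    Function.update (only M k w) k w' = only M k w' :=
  Function.update_idem (β := fun k => List (M.tm.Γ k)) w w' _

theorem only_nil (k : M.tm.K) : only M k [] = fun _ => [] :=
  Function.update_eq_self (β := fun k => List (M.tm.Γ k)) k _

/-- The stack `out` holds the code with its last bit on top; moving it to the input stack of `M`
reverses it into the right order. -/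
theorem flip_loop (w : List Bool) (y : List (M.tm.Γ M.tm.k₀)) :
    ReachesIn (step (prog M d q K)) (w.length + 1)
      (conf (only M M.tm.k₀ y) .flip ⟨i, b, w, e, t, c, a⟩)
      ⟨some (Sum.inl M.tm.main), (M.tm.initialState, none),
        joinStk (only M M.tm.k₀ (w.reverse.map M.inputAlphabet.symm ++ y))
          (Mem.mk i b [] e t c a).stk⟩ := by
  induction w generalizing y with
  | nil => exact .single (by simp; rfl)
  | cons x w ih =>
    refine .head (b := conf (only M M.tm.k₀ (M.inputAlphabet.symm x :: y)) .flip
      ⟨i, b, w, e, t, c, a⟩) (by simp) ?_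
    convert ih (M.inputAlphabet.symm x :: y) using 3 <;> simp

theorem run_machine (s : Mem K) (w w' : List Bool) {u : ℕ}
    (h : Nonempty (TM2OutputsInTime M.tm (w.map M.inputAlphabet.symm)
      (some (w'.map M.outputAlphabet.symm)) u)) :
    ReachesIn (step (prog M d q K)) u
      ⟨some (Sum.inl M.tm.main), (M.tm.initialState, none),
        joinStk (only M M.tm.k₀ (w.map M.inputAlphabet.symm)) s.stk⟩
      (conf (only M M.tm.k₁ (w'.map M.outputAlphabet.symm)) .compare s) := by
  obtain ⟨⟨⟨n, hn⟩, hnu⟩⟩ := h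
  have := ReachesIn.map (g := step (prog M d q K)) (Cfg.embed Label.compare none s.stk)
    (fun a b hab => by
      obtain ⟨_ | l, v, S⟩ := a
      · cases hab
      · cases hab
        exact congrArg some (stepAux_embed _ _ _ _ _ _)) ⟨n, hnu, hn⟩
  convert this using 1
  · rw [only, ← dite_eq_update]
    rfl
  · rw [conf, only, ← dite_eq_update]
    rfl

/-- Output and old minimum are consumed in parallel, and `tmp` grows only while both last. The
stacks of `M` end up empty, ready for the next run. -/
theorem compare_loop (x β : ℕ) :
    ReachesIn (step (prog M d q K)) (x + 1)
      (conf (only M M.tm.k₁ ((encodeUnary x).map M.outputAlphabet.symm)) .compare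
        ⟨i, b, o, List.replicate β true, t, c, a⟩)
      (conf (fun _ => []) .clear ⟨i, b, o, List.replicate (β - x) true,
        List.replicate (min x β) true ++ t, c, a⟩) := by
  induction x generalizing β t with
  | zero => exact .single (by simp [encodeUnary_zero, only_nil])
  | succ x ih =>
    obtain _ | β := β
    · refine .head (b := conf (only M M.tm.k₁ ((encodeUnary x).map M.outputAlphabet.symm)) .compare
        ⟨i, b, o, [], t, c, a⟩) (by simp [encodeUnary_succ]) ?_
      simpa using ih t 0
    · refine .head (b := conf (only M M.tm.k₁ ((encodeUnary x).map M.outputAlphabet.symm)) .compare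
        ⟨i, b, o, List.replicate β true, true :: t, c, a⟩)
        (by simp [encodeUnary_succ, List.replicate_succ]) ?_
      convert ih (true :: t) β using 3
      · simp
      · simp [List.replicate_succ']

theorem clear_loop (w : List Bool) :
    ReachesIn (step (prog M d q K)) (w.length + 1) (conf T .clear ⟨i, b, o, w, t, c, a⟩)
      (conf T .move ⟨i, b, o, [], t, c, a⟩) := by
  induction w with
  | nil => exact .single (by simp)
  | cons x w ih => exact .head (by simp) ih

theorem move_loop (β : ℕ) :
    ReachesIn (step (prog M d q K)) (β + 1)
      (conf T .move ⟨i, b, o, e, List.replicate β true, c, a⟩)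
      (conf T .incr ⟨i, b, o, List.replicate β true ++ e, [], c, a⟩) := by
  induction β generalizing e with
  | zero => exact .single (by simp)
  | succ β ih =>
    refine .head (b := conf T .move ⟨i, b, o, true :: e, List.replicate β true, c, a⟩)
      (by simp [List.replicate_succ]) ?_
    convert ih (true :: e) using 3
    simp [List.replicate_succ']

theorem zeros_loop (w : List (Fin K)) :
    ReachesIn (step (prog M d q K)) (w.length + 1) (conf T .zeros ⟨i, b, o, e, t, c, w⟩)
      (conf T .restore ⟨i, b, o, e, t, w.reverse ++ c, []⟩) := by
  induction w generalizing c with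
  | nil => exact .single (by simp)
  | cons x w ih =>
    refine .head (b := conf T .zeros ⟨i, b, o, e, t, x :: c, w⟩) (by simp) ?_
    convert ih (x :: c) using 3 <;> simp

variable (K) in
/-- The `N` lowest digits of `i` in base `K`, beginning with the lowest one. -/
def digitList : ℕ → ℕ → List (Fin K)
  | 0, _ => []
  | N + 1, i => Fin.ofNat K i :: digitList N (i / K)

@[simp]
theorem length_digitList (N k : ℕ) : (digitList K N k).length = N := by
  induction N generalizing k with
  | zero => rfl
  | succ N ih => simp [digitList, ih]

theorem digitList_zero (N : ℕ) : digitList K N 0 = List.replicate N 0 := by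
  induction N with
  | zero => rfl
  | succ N ih =>
    rw [digitList, Nat.zero_div, ih, List.replicate_succ]
    rfl

/-- The counter enumerates every choice of blocks. -/
theorem exists_digitList_eq (l : List (Fin K)) :
    ∃ k < K ^ l.length, digitList K l.length k = l := by
  induction l with
  | nil => exact ⟨0, by simp, rfl⟩
  | cons x l ih =>
    obtain ⟨k, hk, h⟩ := ih
    refine ⟨x + K * k, ?_, ?_⟩
    · rw [List.length_cons, pow_succ']
      calc x + K * k < K + K * k := by omega
        _ = K * (k + 1) := by ring
        _ ≤ _ := Nat.mul_le_mul_left _ hk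
    · rw [List.length_cons, digitList, Nat.add_mul_div_left _ _ (NeZero.pos K),
        Nat.div_eq_of_lt x.2, zero_add, h]
      congr 1
      ext
      simp [Nat.mod_eq_of_lt x.2]

theorem digitList_carry (N k : ℕ) (hk : ¬ k % K + 1 < K) :
    digitList K (N + 1) (k + 1) = 0 :: digitList K N (k / K + 1) ∧ k % K + 1 = K ∧
      k + 1 = K * (k / K + 1) := by
  have hK : k % K + 1 = K := le_antisymm (Nat.mod_lt _ (NeZero.pos K)) (not_lt.1 hk)
  have h : k + 1 = K * (k / K + 1) := by linarith [Nat.mod_add_div k K]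
  refine ⟨?_, hK, h⟩
  rw [digitList, h, Nat.mul_div_cancel_left _ (NeZero.pos K)]
  congr 1
  ext
  simp

theorem incr_loop (N k : ℕ) (h : k + 1 < K ^ N) :
    ReachesIn (step (prog M d q K)) (2 * N + a.length + 1)
      (conf T .incr ⟨i, b, o, e, t, digitList K N k, a⟩)
      (conf T .restore ⟨i, b, o, e, t, a.reverse ++ digitList K N (k + 1), []⟩) := by
  induction N generalizing k a with
  | zero => simp at h
  | succ N ih =>
    by_cases hk : k % K + 1 < K
    · obtain ⟨h₁, h₂⟩ := (Nat.div_mod_unique (NeZero.pos K)).2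
        ⟨(by linarith [Nat.mod_add_div k K] : k % K + 1 + K * (k / K) = k + 1), hk⟩
      have h₃ : digitList K (N + 1) (k + 1) = ⟨k % K + 1, hk⟩ :: digitList K N (k / K) := by
        rw [digitList, h₁]
        congr 1
        exact Fin.ext h₂
      rw [h₃]
      exact (ReachesIn.head (by simp [digitList, hk]) (zeros_loop i b o e t _ a)).mono (by omega)
    · obtain ⟨h₁, h₂, h₃⟩ := digitList_carry N k hk
      rw [h₁]
      rw [h₃, pow_succ'] at h
      have := ih (0 :: a) (k / K) (lt_of_mul_lt_mul_left h (Nat.zero_le K))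
      rw [List.reverse_cons, List.append_assoc] at this
      exact (ReachesIn.head (by simp [digitList, hk]) this).mono (by simp; omega)

/-- At the last counter value every digit is `K - 1`, so the carry runs off the end; this ends the
enumeration. -/
theorem incr_overflow (N k : ℕ) (h : k + 1 = K ^ N) :
    ∃ a', a'.length = N + a.length ∧ ReachesIn (step (prog M d q K)) (N + 1)
      (conf T .incr ⟨i, b, o, e, t, digitList K N k, a⟩)
      (conf T .wipe ⟨i, b, o, e, t, [], a'⟩) := by
  induction N generalizing k a with
  | zero => exact ⟨a, by simp, .single (by simp [digitList])⟩
  | succ N ih =>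
    have hk : ¬ k % K + 1 < K := by
      intro hk
      have := (Nat.div_mod_unique (NeZero.pos K)).2
        ⟨(by linarith [Nat.mod_add_div k K] : k % K + 1 + K * (k / K) = k + 1), hk⟩
      rw [h, pow_succ'] at this
      simp at this
    obtain ⟨h₁, h₂, h₃⟩ := digitList_carry N k hk
    rw [h₃, pow_succ'] at h
    obtain ⟨a', ha', h'⟩ := ih (0 :: a) (k / K) (Nat.eq_of_mul_eq_mul_left (NeZero.pos K) h)
    exact ⟨a', by simp at ha'; omega, .head (by simp [digitList, hk]) h'⟩

theorem wipe_loop (w : List Bool) :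
    ReachesIn (step (prog M d q K)) (w.length + 1) (conf T .wipe ⟨i, w, o, e, t, c, a⟩)
      (conf T .wipeAux ⟨i, [], o, e, t, c, a⟩) := by
  induction w with
  | nil => exact .single (by simp)
  | cons x w ih => exact .head (by simp) ih

theorem wipeAux_loop (w : List (Fin K)) :
    ReachesIn (step (prog M d q K)) (w.length + 1) (conf T .wipeAux ⟨i, b, o, e, t, c, w⟩)
      (conf T .answer ⟨i, b, o, e, false :: t, c, []⟩) := by
  induction w with
  | nil => exact .single (by simp)
  | cons x w ih => exact .head (by simp) ih

theorem answer_loop (β : ℕ) :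
    ReachesIn (step (prog M d q K)) (β + 1)
      (conf T .answer ⟨i, b, o, List.replicate β true, t, c, a⟩)
      ⟨none, (M.tm.initialState, none),
        joinStk T (Mem.mk i b o [] (List.replicate β true ++ t) c a).stk⟩ := by
  induction β generalizing t with
  | zero => exact .single (by simp; rfl)
  | succ β ih =>
    refine .head (b := conf T .answer ⟨i, b, o, List.replicate β true, true :: t, c, a⟩)
      (by simp [List.replicate_succ]) ?_
    convert ih (true :: t) using 4
    simp [List.replicate_succ']

end Loops

end MinMachine

/-! ### One run, all runs, the whole computation -/

namespace MinMachine

variable {M : TM2ComputableAux Bool Bool} {d q K r : ℕ} [NeZero q] [NeZero K]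

theorem encode_eq (φ : ThreeCNF) :
    φ.encode = encodeUnary φ.numVars ++ encodeListWith encodeClause φ.clauses := rfl

/-- One run of `M`, on the instance that belongs to the counter `c`. -/
theorem iteration (hr : 3 ≤ r) (φ : ThreeCNF) (c : List (Fin K)) (hc : c.length = φ.numVars / q + 1)
    (β x u : ℕ)
    (h : Nonempty (TM2OutputsInTime M.tm
      ((restrict (d := d) (r := r) q hr c φ).encode.map M.inputAlphabet.symm)
      (some ((encodeUnary x).map M.outputAlphabet.symm)) u)) :
    ReachesIn (step (prog M d q K))
      (3 * φ.encode.length + (restrict (d := d) (r := r) q hr c φ).encode.length + u + x + 2 * β + 5)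
      (conf (fun _ => []) .restore
        ⟨[], φ.encode.reverse, [], List.replicate β true, [], c, []⟩)
      (conf (fun _ => []) .incr
        ⟨[], φ.encode.reverse, [], List.replicate (min x β) true, [], c, []⟩) := by
  have h₁ := restore_loop (M := M) (d := d) (q := q) (T := fun _ => []) [] []
    (List.replicate β true) [] c [] φ.encode.reverse
  have h₂ := read_number (M := M) (d := d) (q := q) (T := fun _ => [])
    (encodeListWith encodeClause φ.clauses) [] [true] (List.replicate β true) [] c φ.numVars
    (by omega)
  have h₃ := clause_loop (M := M) (d := d) (q := q) (T := fun _ => []) []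
    ((encodeUnary φ.numVars).reverse ++ []) ((encodeUnary (φ.numVars / q)).reverse ++ [true])
    (List.replicate β true) [] c hr φ.clauses (by omega)
  have h₄ := flip_loop (M := M) (d := d) (q := q) [] φ.encode.reverse (List.replicate β true) [] c []
    (restrict (d := d) (r := r) q hr c φ).encode.reverse []
  have h₅ := run_machine (d := d) (q := q) (K := K)
    ⟨[], φ.encode.reverse, [], List.replicate β true, [], c, []⟩ _ _ h
  have h₆ := compare_loop (M := M) (d := d) (q := q) [] φ.encode.reverse [] [] c [] x β
  have h₇ := clear_loop (M := M) (d := d) (q := q) (T := fun _ => []) [] φ.encode.reverse []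
    (List.replicate (min x β) true) c [] (List.replicate (β - x) true)
  have h₈ := move_loop (M := M) (d := d) (q := q) (T := fun _ => []) [] φ.encode.reverse [] []
    c [] (min x β)
  rw [List.append_nil] at h₆ h₈
  rw [List.reverse_reverse, List.append_nil] at h₁ h₄
  rw [List.append_nil, List.append_nil, ← List.reverse_append, ← encode_eq] at h₃
  -- The bit `true` that `restore` leaves at the bottom of `out` turns the unary code of `n / q`
  -- into that of `n / q + 1`.
  have e : (encodeListWith CSPConstraint.encode
      (φ.clauses.map (restrictClause (r := r) d q hr c))).reverse ++
      ((encodeUnary (φ.numVars / q)).reverse ++ [true]) =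
      (restrict (d := d) (r := r) q hr c φ).encode.reverse := by
    simp [CSPInstance.encode, restrict, encodeUnary_succ]
  rw [e] at h₃
  rw [only_nil] at h₄
  rw [List.append_nil] at h₂
  refine (h₁.trans (h₂.trans (h₃.trans (h₄.trans (h₅.trans (h₆.trans (h₇.trans h₈))))))).mono ?_
  have := congrArg List.length (encode_eq φ)
  simp at this ⊢
  omega

/-- The minimum of `β` and the values of `g` below `k`. -/
def minUpTo (β : ℕ) (g : ℕ → ℕ) : ℕ → ℕ
  | 0 => β
  | k + 1 => min (g k) (minUpTo β g k)

theorem minUpTo_le (β : ℕ) (g : ℕ → ℕ) (k : ℕ) : minUpTo β g k ≤ β := by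
  induction k with
  | zero => exact le_rfl
  | succ k ih => exact (min_le_right _ _).trans ih

theorem minUpTo_le_apply (β : ℕ) (g : ℕ → ℕ) {i k : ℕ} (h : i < k) : minUpTo β g k ≤ g i := by
  induction k with
  | zero => simp at h
  | succ k ih =>
    obtain h | rfl := Nat.lt_succ_iff_lt_or_eq.1 h
    · exact (min_le_right _ _).trans (ih h)
    · exact min_le_left _ _

theorem le_minUpTo {x β : ℕ} {g : ℕ → ℕ} {k : ℕ} (hβ : x ≤ β) (hg : ∀ i < k, x ≤ g i) :
    x ≤ minUpTo β g k := by
  induction k with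
  | zero => exact hβ
  | succ k ih => exact le_min (hg k (by omega)) (ih fun i hi => hg i (by omega))

/-- All iterations up to number `k`. -/
theorem iterations (hr : 3 ≤ r) (φ : ThreeCNF) {β u B : ℕ} {g : ℕ → ℕ} {N : ℕ}
    (hN : N = φ.numVars / q + 1)
    (h : ∀ k < K ^ N, Nonempty (TM2OutputsInTime M.tm
      ((restrict (d := d) (r := r) q hr (digitList K N k) φ).encode.map M.inputAlphabet.symm)
      (some ((encodeUnary (g k)).map M.outputAlphabet.symm)) u))
    (hB : ∀ k < K ^ N, 3 * φ.encode.length +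
      (restrict (d := d) (r := r) q hr (digitList K N k) φ).encode.length + u + g k + 2 * β +
        2 * N + 6 ≤ B)
    (k : ℕ) (hk : k < K ^ N) :
    ReachesIn (step (prog M d q K)) ((k + 1) * B)
      (conf (fun _ => []) .restore
        ⟨[], φ.encode.reverse, [], List.replicate β true, [], List.replicate N 0, []⟩)
      (conf (fun _ => []) .incr
        ⟨[], φ.encode.reverse, [], List.replicate (minUpTo β g (k + 1)) true, [],
          digitList K N k, []⟩) := by
  induction k with
  | zero =>
    rw [← digitList_zero]
    refine (iteration hr φ _ (by simp [hN]) β (g 0) u (h 0 hk)).mono ?_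
    have := hB 0 hk
    omega
  | succ k ih =>
    have h₁ := incr_loop (M := M) (d := d) (q := q) (T := fun _ => []) [] φ.encode.reverse []
      (List.replicate (minUpTo β g (k + 1)) true) [] [] N k hk
    have h₂ := iteration hr φ _ (by simp [hN]) (minUpTo β g (k + 1)) (g (k + 1)) u (h (k + 1) hk)
    refine ((ih (by omega)).trans (h₁.trans h₂)).mono ?_
    have := hB (k + 1) hk
    have := minUpTo_le β g (k + 1)
    have e : (k + 1 + 1) * B = (k + 1) * B + B := by ring
    rw [e, List.length_nil]
    omega

/-- The whole computation. -/
theorem computation (hr : 3 ≤ r) (φ : ThreeCNF) {u B : ℕ} {g : ℕ → ℕ} {N : ℕ}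
    (hN : N = φ.numVars / q + 1)
    (h : ∀ k < K ^ N, Nonempty (TM2OutputsInTime M.tm
      ((restrict (d := d) (r := r) q hr (digitList K N k) φ).encode.map M.inputAlphabet.symm)
      (some ((encodeUnary (g k)).map M.outputAlphabet.symm)) u))
    (hB : ∀ k < K ^ N, 5 * φ.encode.length +
      (restrict (d := d) (r := r) q hr (digitList K N k) φ).encode.length + u + g k +
        2 * N + 6 ≤ B) :
    ReachesIn (step (prog M d q K)) ((K ^ N + 2) * B)
      (conf (fun _ => []) (.size 0) ⟨φ.encode, [], [], [], [], [], []⟩)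
      ⟨none, (M.tm.initialState, none), joinStk (fun _ => []) (Mem.mk [] [] [] []
        (encodeUnary (minUpTo (encodeListWith encodeClause φ.clauses).length g (K ^ N)))
          [] []).stk⟩ := by
  set w := encodeListWith encodeClause φ.clauses with hw
  have hpos : 0 < K ^ N := pow_pos (NeZero.pos K) N
  obtain ⟨k, hk⟩ : ∃ k, K ^ N = k + 1 := ⟨K ^ N - 1, by omega⟩
  have hlen : φ.encode.length = φ.numVars + 1 + w.length := by simp [encode_eq, hw]
  have h₁ := size_loop (M := M) (d := d) (q := q) (K := K) (T := fun _ => []) w [] [] [] [] [] []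
    φ.numVars 0
  have h₂ := bound_loop (M := M) (d := d) (q := q) (K := K) (T := fun _ => [])
    ((encodeUnary φ.numVars).reverse ++ []) [] [] [] (List.replicate N 0) [] w
  -- The coefficient 5 is 3 from `iterations` plus 2 for `2 * β`, as `β` is at most the length of
  -- the code.
  have h₃ := iterations (d := d) (q := q) (K := K) hr φ (β := w.length) hN h
    (fun k hk => le_trans (by omega) (hB k hk)) k (by omega)
  obtain ⟨a', ha', h₄⟩ := incr_overflow (M := M) (d := d) (q := q) (T := fun _ => []) []
    φ.encode.reverse [] (List.replicate (minUpTo w.length g (k + 1)) true) [] [] N k hk.symm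
  have h₅ := wipe_loop (M := M) (d := d) (q := q) (T := fun _ => []) [] []
    (List.replicate (minUpTo w.length g (k + 1)) true) [] [] a' φ.encode.reverse
  have h₆ := wipeAux_loop (M := M) (d := d) (q := q) (T := fun _ => []) [] [] []
    (List.replicate (minUpTo w.length g (k + 1)) true) [] [] a'
  have h₇ := answer_loop (M := M) (d := d) (q := q) (K := K) (T := fun _ => []) [] [] [] [false] [] []
    (minUpTo w.length g (k + 1))
  simp only [Fin.val_zero, zero_add, List.append_nil, ← hN] at h₁
  rw [List.append_nil, List.append_nil, ← List.reverse_append, ← encode_eq] at h₂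
  have hβ := minUpTo_le w.length g (k + 1)
  have hB0 := hB 0 hpos
  rw [hk]
  -- The runs take `K ^ N * B` steps; setup and cleanup fit into the remaining `2 * B`.
  refine (h₁.trans (h₂.trans (h₃.trans (h₄.trans (h₅.trans (h₆.trans h₇)))))).mono ?_
  simp at ha' ⊢
  linarith

end MinMachine

/-! ### Optimal values -/

theorem minDeletions_le_length {A L : Type} [Nonempty A] (sat : A → L → Prop) (cs : List L) :
    minDeletions sat cs ≤ cs.length :=
  Nat.sInf_le ⟨Finset.univ, by simp, Classical.arbitrary A, by simp⟩

/-- Deletions and an assignment can be carried over to a list of constraints that are implied. -/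
theorem minDeletions_le_card {A A' L L' : Type} {sat : A → L → Prop} {sat' : A' → L' → Prop}
    {cs : List L} {cs' : List L'} (h : cs'.length = cs.length) {a : A} {a' : A'}
    (H : ∀ i, sat' a' (cs'.get i) → sat a (cs.get (i.cast h))) {S : Finset (Fin cs'.length)}
    (hS : ∀ i, i ∉ S → sat' a' (cs'.get i)) : minDeletions sat cs ≤ S.card := by
  refine Nat.sInf_le ⟨S.map (finCongr h).toEmbedding, by simp, a, fun i hi => ?_⟩
  refine H (i.cast h.symm) (hS _ fun hi' => hi ?_)
  exact Finset.mem_map.2 ⟨_, hi', by simp⟩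

theorem exists_minDeletions {A L : Type} [Nonempty A] (sat : A → L → Prop) (cs : List L) :
    ∃ S : Finset (Fin cs.length), S.card = minDeletions sat cs ∧
      ∃ a : A, ∀ i : Fin cs.length, i ∉ S → sat a (cs.get i) :=
  Nat.sInf_mem (s := {k : ℕ | ∃ S : Finset (Fin cs.length), S.card = k ∧
    ∃ a : A, ∀ i : Fin cs.length, i ∉ S → sat a (cs.get i)})
    ⟨_, Finset.univ, rfl, Classical.arbitrary A, by simp⟩

/-! ### Covering the cube by blocks -/

namespace MinMachine

variable {d q K r n : ℕ} [NeZero q] [NeZero K]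

/-- The valuation given by the values of the groups. -/
def decode (c : List (Fin K)) (a : Fin (n / q + 1) → Fin d) (v : Fin n) : Bool :=
  ((c.getD (v / q) 0).1 * d +
    (a ⟨v / q, Nat.lt_succ_of_le (Nat.div_le_div_right v.2.le)⟩).1).testBit (v % q)

theorem sat_restrictClause (hr : 3 ≤ r) (c : List (Fin K)) (a : Fin (n / q + 1) → Fin d)
    (C : ThreeClause n) : (restrictClause d q hr c C).Sat a ↔ C.Sat (decode c a) := by
  refine (mem_rel_restrictClause hr c C _).trans ?_
  constructor
  · rintro ⟨i, hi⟩
    exact ⟨_, List.get_mem _ i, hi⟩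
  · rintro ⟨l, hl, h⟩
    obtain ⟨i, rfl⟩ := List.get_of_mem hl
    exact ⟨i, h⟩

/-- Decoding an optimal assignment keeps the set of deleted positions. Any `c` will do: missing
digits are read as 0 in both `toLit` and `decode`. -/
theorem opt_le_opt_restrict [NeZero d] (hr : 3 ≤ r) (c : List (Fin K)) (φ : ThreeCNF) :
    φ.opt ≤ (restrict (d := d) q hr c φ).opt := by
  obtain ⟨S, hS, a, ha⟩ := exists_minDeletions CSPConstraint.Sat
    (restrict (d := d) q hr c φ).constraints
  rw [CSPInstance.opt, ← hS]
  refine minDeletions_le_card (by simp [restrict]) (a := decode c a) (fun i hi => ?_) ha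
  exact (sat_restrictClause hr c a _).1 (cast (congrArg (CSPConstraint.Sat a)
    (List.getElem_map (restrictClause (r := r) d q hr c))) hi)

theorem exists_decode_eq (hK : 2 ^ q ≤ K * d) (a : Fin n → Bool) :
    ∃ c : List (Fin K), c.length = n / q + 1 ∧
      ∃ a' : Fin (n / q + 1) → Fin d, decode c a' = a := by
  have hd : 0 < d := by
    rcases Nat.eq_zero_or_pos d with rfl | h
    · simp at hK
    · exact h
  -- The vertex of group `g` as a number, padded with `false` beyond the last variable; its quotient
  -- by `d` is the block, its remainder the value in the block.
  let w (g : ℕ) : ℕ :=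
    Nat.ofBits fun j : Fin q => if h : g * q + j < n then a ⟨g * q + j, h⟩ else false
  have hw (g : ℕ) : w g < K * d := (Nat.ofBits_lt_two_pow _).trans_le hK
  refine ⟨List.ofFn fun g : Fin (n / q + 1) => ⟨w g / d, Nat.div_lt_of_lt_mul (by
    rw [mul_comm]; exact hw g)⟩, by simp, fun g => ⟨w g % d, Nat.mod_lt _ hd⟩, ?_⟩
  funext v
  have hv : v.1 / q < n / q + 1 := Nat.lt_succ_of_le (Nat.div_le_div_right v.2.le)
  have e : v.1 / q * q + v.1 % q = v := Nat.div_add_mod' _ _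
  rw [decode, List.getD_eq_getElem _ _ (by simpa using hv)]
  simp only [List.getElem_ofFn, Nat.div_add_mod', w]
  rw [Nat.testBit_ofBits_lt _ _ (Nat.mod_lt _ (NeZero.pos q))]
  simp [e]

theorem exists_opt_restrict_le (hK : 2 ^ q ≤ K * d) (hr : 3 ≤ r) (φ : ThreeCNF) :
    ∃ c : List (Fin K), c.length = φ.numVars / q + 1 ∧
      (restrict (d := d) q hr c φ).opt ≤ φ.opt := by
  obtain ⟨S, hS, a, ha⟩ := exists_minDeletions ThreeClause.Sat φ.clauses
  obtain ⟨c, hc, a', rfl⟩ := exists_decode_eq hK a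
  refine ⟨c, hc, ?_⟩
  rw [ThreeCNF.opt, ← hS]
  refine minDeletions_le_card (by simp [restrict]) (a := a') (fun i hi => ?_) ha
  exact cast (congrArg (CSPConstraint.Sat a')
    (List.getElem_map (restrictClause (r := r) d q hr c)).symm) ((sat_restrictClause hr c a' _).2 hi)

theorem minUpTo_opt_restrict [NeZero d] (hK : 2 ^ q ≤ K * d) (hr : 3 ≤ r) (φ : ThreeCNF) {β N : ℕ}
    (hβ : φ.clauses.length ≤ β) (hN : N = φ.numVars / q + 1) :
    minUpTo β (fun k => (restrict (d := d) q hr (digitList K N k) φ).opt) (K ^ N) = φ.opt := by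
  refine le_antisymm ?_ (le_minUpTo ((minDeletions_le_length _ _).trans hβ)
    fun k _ => opt_le_opt_restrict hr _ φ)
  obtain ⟨c, hc, h⟩ := exists_opt_restrict_le hK hr φ
  obtain ⟨k, hk, e⟩ := exists_digitList_eq c
  rw [hc, ← hN] at hk e
  refine (minUpTo_le_apply _ _ hk).trans ?_
  rwa [e]

/-! ### Lengths of codes -/

theorem length_encodeListWith_le {α : Type} {e : α → List Bool} {l : List α} {B : ℕ}
    (h : ∀ x ∈ l, (e x).length ≤ B) : (encodeListWith e l).length ≤ l.length * (B + 1) + 1 := by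
  induction l with
  | nil => simp [encodeListWith_nil]
  | cons x l ih =>
    have h₁ := ih fun y hy => h y (by simp [hy])
    have h₂ := h x (by simp)
    rw [encodeListWith_cons]
    simp only [List.length_cons, List.length_append]
    linarith

theorem length_encode_le (φ : ThreeCNF) :
    φ.encode.length ≤ 10 * (φ.numVars + φ.clauses.length + 1) ^ 2 := by
  have h (C : ThreeClause φ.numVars) : (encodeClause C).length ≤ 3 * (φ.numVars + 2) + 1 := by
    refine (length_encodeListWith_le (B := φ.numVars + 1) fun l _ => ?_).trans ?_
    · have := l.1.2
      simp [encodeLiteral]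
    · gcongr
      exact C.length_le
  have := length_encodeListWith_le (l := φ.clauses) fun C _ => h C
  rw [encode_eq, List.length_append, length_encodeUnary]
  nlinarith

theorem length_encode_restrict_le [NeZero d] (hr : 3 ≤ r) (c : List (Fin K)) (φ : ThreeCNF) :
    (restrict (d := d) q hr c φ).encode.length ≤
      (12 + d ^ 3) * (φ.numVars + φ.clauses.length + 1) ^ 2 := by
  have hq := Nat.div_le_self φ.numVars q
  have h (C : ThreeClause φ.numVars) : (restrictClause (r := r) d q hr c C).encode.length ≤
      3 * (φ.numVars + 2) + 1 + d ^ 3 := by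
    rw [encode_restrictClause, List.length_append]
    gcongr
    · refine (length_encodeListWith_le (B := φ.numVars + 1) fun l _ => ?_).trans ?_
      · have := l.1.2
        have := Nat.div_le_self l.1 q
        simp
        omega
      · gcongr
        exact C.length_le
    · simp only [table, tableFn, List.length_ofFn, List.length_map]
      exact Nat.pow_le_pow_right (NeZero.pos d) C.length_le
  have := length_encodeListWith_le (e := CSPConstraint.encode)
    (l := φ.clauses.map (restrictClause (r := r) d q hr c)) (by simpa using fun C _ => h C)
  rw [List.length_map] at this
  rw [CSPInstance.encode, List.length_append, length_encodeUnary]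
  simp only [restrict]
  refine (Nat.add_le_add_left this _).trans ?_
  have h1 : φ.clauses.length * d ^ 3 ≤ d ^ 3 * (φ.numVars + φ.clauses.length + 1) ^ 2 := by
    rw [mul_comm]
    gcongr
    nlinarith
  nlinarith

end MinMachine

/-! ### Finiteness of the control, and the machine as a whole -/

namespace MinMachine

section Finite

variable {q K : ℕ}

instance : Fintype Stack where
  elems := {.inp, .bak, .out, .best, .tmp, .ctr, .aux}
  complete := by rintro ⟨⟩ <;> simp

instance : Finite (Lits q K) := List.finite_length_le (Lit q K) 3

/-- All labels, by their kind. -/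
def toLabel : Fin q ⊕ (Option (Lits q K) × Fin q) ⊕ Option (Lits q K) ⊕ Lits q K ⊕ Fin 12 →
    Label q K
  | .inl j => .size j
  | .inr (.inl p) => .read p.1 p.2
  | .inr (.inr (.inl m)) => .emit m
  | .inr (.inr (.inr (.inl L))) => .literal L
  | .inr (.inr (.inr (.inr i))) =>
    ![.bound, .restore, .clause, .flip, .compare, .clear, .move, .incr, .zeros, .wipe, .wipeAux,
      .answer] i

instance : Finite (Label q K) := by
  refine Finite.of_surjective toLabel fun l => ?_
  cases l with
  | size j => exact ⟨.inl j, rfl⟩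
  | read m j => exact ⟨.inr (.inl (m, j)), rfl⟩
  | emit m => exact ⟨.inr (.inr (.inl m)), rfl⟩
  | literal L => exact ⟨.inr (.inr (.inr (.inl L))), rfl⟩
  | bound => exact ⟨.inr (.inr (.inr (.inr 0))), rfl⟩
  | restore => exact ⟨.inr (.inr (.inr (.inr 1))), rfl⟩
  | clause => exact ⟨.inr (.inr (.inr (.inr 2))), rfl⟩
  | flip => exact ⟨.inr (.inr (.inr (.inr 3))), rfl⟩
  | compare => exact ⟨.inr (.inr (.inr (.inr 4))), rfl⟩
  | clear => exact ⟨.inr (.inr (.inr (.inr 5))), rfl⟩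
  | move => exact ⟨.inr (.inr (.inr (.inr 6))), rfl⟩
  | incr => exact ⟨.inr (.inr (.inr (.inr 7))), rfl⟩
  | zeros => exact ⟨.inr (.inr (.inr (.inr 8))), rfl⟩
  | wipe => exact ⟨.inr (.inr (.inr (.inr 9))), rfl⟩
  | wipeAux => exact ⟨.inr (.inr (.inr (.inr 10))), rfl⟩
  | answer => exact ⟨.inr (.inr (.inr (.inr 11))), rfl⟩

end Finite

/-- The machine, with input stack `inp` and output stack `tmp`. -/
noncomputable def machine (M : TM2ComputableAux Bool Bool) (d q K : ℕ) [NeZero q] [NeZero K] :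
    TM2ComputableAux Bool Bool where
  tm :=
    { K := M.tm.K ⊕ Stack
      kDecidableEq := instDecidableEqSum
      kFin := @instFintypeSum _ _ M.tm.kFin _
      k₀ := Sum.inr .inp
      k₁ := Sum.inr .tmp
      Γ := Sum.elim M.tm.Γ (Alph K)
      Λ := M.tm.Λ ⊕ Label q K
      main := Sum.inr (.size 0)
      ΛFin := @instFintypeSum _ _ M.tm.ΛFin (Fintype.ofFinite _)
      σ := M.tm.σ × Option (Bool ⊕ Fin K)
      initialState := (M.tm.initialState, none)
      σFin := @instFintypeProd _ _ M.tm.σFin _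
      Γk₀Fin := inferInstanceAs (Fintype Bool)
      m := prog M d q K }
  inputAlphabet := Equiv.refl Bool
  outputAlphabet := Equiv.refl Bool

theorem joinStk_empty {M : TM2ComputableAux Bool Bool} {K : ℕ} :
    joinStk (fun _ => [] : ∀ k, List (M.tm.Γ k)) (Mem.mk [] [] [] [] [] [] [] : Mem K).stk =
      fun _ => [] := by
  funext k
  rcases k with k | k
  · rfl
  · cases k <;> rfl

/-- The output convention demands that all stacks except `tmp` be empty and the state be initial,
which is why the program wipes `bak` and `aux` before it answers. -/
theorem outputsInTime {M : TM2ComputableAux Bool Bool} {d q K : ℕ} [NeZero q] [NeZero K]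
    {w w' : List Bool} {t : ℕ} (h : ReachesIn (step (prog M d q K)) t
      (conf (fun _ => []) (.size 0) ⟨w, [], [], [], [], [], []⟩)
      ⟨none, (M.tm.initialState, none),
        joinStk (fun _ => []) (Mem.mk [] [] [] [] w' [] []).stk⟩) :
    Nonempty (TM2OutputsInTime (machine M d q K).tm
      (w.map (machine M d q K).inputAlphabet.symm)
      (some (w'.map (machine M d q K).outputAlphabet.symm)) t) := by
  obtain ⟨s, hs, e⟩ := h
  refine ⟨⟨⟨s, ?_⟩, hs⟩⟩
  have h₁ : initList (machine M d q K).tm (w.map (machine M d q K).inputAlphabet.symm) =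
      conf (fun _ => []) (.size 0) ⟨w, [], [], [], [], [], []⟩ := by
    rw [initList, dite_eq_update]
    have := update_joinStk_stk (fun _ => [] : ∀ k, List (M.tm.Γ k))
      (Mem.mk [] [] [] [] [] [] [] : Mem K) .inp w
    rw [joinStk_empty] at this
    have hw : (w.map (machine M d q K).inputAlphabet.symm : List Bool) = w := List.map_id w
    exact congrArg (Cfg.mk (Γ := Sum.elim M.tm.Γ (Alph K)) (Λ := M.tm.Λ ⊕ Label q K)
      (some (Sum.inr (.size 0))) (M.tm.initialState, none)) ((congrArg
        (Function.update (β := fun k => List (Sum.elim M.tm.Γ (Alph K) k)) (fun _ => [])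
          (Sum.inr Stack.inp)) hw).trans this)
  have h₂ : haltList (machine M d q K).tm (w'.map (machine M d q K).outputAlphabet.symm) =
      ⟨none, (M.tm.initialState, none),
        joinStk (fun _ => []) (Mem.mk [] [] [] [] w' [] []).stk⟩ := by
    rw [haltList, dite_eq_update]
    have := update_joinStk_stk (fun _ => [] : ∀ k, List (M.tm.Γ k))
      (Mem.mk [] [] [] [] [] [] [] : Mem K) .tmp w'
    rw [joinStk_empty] at this
    have hw : (w'.map (machine M d q K).outputAlphabet.symm : List Bool) = w' := List.map_id w'
    exact congrArg (Cfg.mk (Γ := Sum.elim M.tm.Γ (Alph K)) (Λ := M.tm.Λ ⊕ Label q K)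
      (none) (M.tm.initialState, none)) ((congrArg
        (Function.update (β := fun k => List (Sum.elim M.tm.Γ (Alph K) k)) (fun _ => [])
          (Sum.inr Stack.tmp)) hw).trans this)
  rw [h₁, Option.map_some, h₂]
  exact e

end MinMachine

/-! ### Running time and choice of parameters -/

namespace MinMachine

/-- The total number of steps is within the bound `b' ^ n * (n + m) ^ O(1)` if `(K * b) ^ (1 / q)`
is at most `b'`. -/
theorem total_time_le {q K C k D n m : ℕ} [NeZero q] [NeZero K] {b b' : ℝ} (hb : 1 ≤ b)
    (hb' : K * b ≤ b' ^ q) (hb'₁ : 1 ≤ b') :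
    (((K ^ (n / q + 1) + 2) * ((80 + D) * (n + m + 1) ^ 2 +
      ⌊C * b ^ (n / q + 1) * (((n / q + 1 : ℕ) : ℝ) + m + 1) ^ k⌋₊) : ℕ) : ℝ) ≤
      ((⌈3 * (K * b) * (80 + D + C * 2 ^ k)⌉₊ : ℕ) : ℝ) * b' ^ n * ((n : ℝ) + m + 1) ^ (k + 2) := by
  have hK : (1 : ℝ) ≤ K := by exact_mod_cast NeZero.one_le
  set N := n / q + 1 with hN
  set s : ℝ := (n : ℝ) + m + 1 with hs
  have hs1 : 1 ≤ s := by
    rw [hs]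
    have : (0 : ℝ) ≤ n := by positivity
    have : (0 : ℝ) ≤ m := by positivity
    linarith
  have hNn : (N : ℝ) ≤ n + 1 := by
    rw [hN]
    exact_mod_cast Nat.succ_le_succ (Nat.div_le_self n q)
  have hbN : 1 ≤ b ^ N := one_le_pow₀ hb
  have hKN : (1 : ℝ) ≤ K ^ N := one_le_pow₀ hK
  have hsk : 1 ≤ s ^ k := one_le_pow₀ hs1
  have hs2 : 1 ≤ s ^ 2 := one_le_pow₀ hs1
  have h₁ : ((⌊C * b ^ N * ((N : ℝ) + m + 1) ^ k⌋₊ : ℕ) : ℝ) ≤ C * b ^ N * (2 * s) ^ k := by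
    refine (Nat.floor_le (by positivity)).trans ?_
    gcongr
    have : (0 : ℝ) ≤ m := by positivity
    linarith
  -- The additional group costs only the constant factor `K * b`.
  have h₂ : (K * b) ^ N ≤ K * b * b' ^ n := by
    rw [hN, pow_succ']
    gcongr
    calc (K * b) ^ (n / q) ≤ (b' ^ q) ^ (n / q) := by gcongr
      _ = b' ^ (q * (n / q)) := (pow_mul _ _ _).symm
      _ ≤ b' ^ n := pow_le_pow_right₀ hb'₁ (Nat.mul_div_le n q)
  push_cast
  rw [← hs]
  calc ((K : ℝ) ^ N + 2) * ((80 + D) * s ^ 2 + (⌊C * b ^ N * ((N : ℝ) + m + 1) ^ k⌋₊ : ℕ))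
      ≤ (3 * K ^ N) * ((80 + D) * (b ^ N * s ^ 2 * s ^ k) +
          C * b ^ N * (2 ^ k * s ^ k * s ^ 2)) := by
        gcongr
        · linarith
        · calc s ^ 2 = 1 * s ^ 2 * 1 := by ring
            _ ≤ b ^ N * s ^ 2 * s ^ k := by gcongr
        · refine h₁.trans ?_
          rw [mul_pow]
          exact mul_le_mul_of_nonneg_left (le_mul_of_one_le_right (by positivity) hs2)
            (by positivity)
    _ = 3 * (K * b) ^ N * (80 + D + C * 2 ^ k) * s ^ (k + 2) := by
        rw [mul_pow]
        ring
    _ ≤ 3 * (K * b * b' ^ n) * (80 + D + C * 2 ^ k) * s ^ (k + 2) := by gcongr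
    _ = (3 * (K * b) * (80 + D + C * 2 ^ k)) * b' ^ n * s ^ (k + 2) := by ring
    _ ≤ _ := by
        gcongr
        exact Nat.le_ceil _

/-- An algorithm for Max-CSP in time `b ^ n` yields one for Max 3-Sat in time `b' ^ n` if `K` parts
of size `d` cover the cube of dimension `q` and `K * b ≤ b' ^ q`. -/
theorem maxThreeSatSolvable {d r q K : ℕ} [NeZero d] [NeZero q] [NeZero K] (hr : 3 ≤ r)
    (hK : 2 ^ q ≤ K * d) {b b' : ℝ} (hb : 1 ≤ b) (hb' : K * b ≤ b' ^ q) (hb'₁ : 1 ≤ b')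
    (h : MaxCSPSolvable d r b) : MaxThreeSatSolvable b' := by
  obtain ⟨M, hM, C, k, h⟩ := h
  refine ⟨machine M d q K, ?_, ⌈3 * (K * b) * (80 + (d ^ 3 : ℕ) + C * 2 ^ k)⌉₊, k + 2,
    fun φ => ⟨_, total_time_le (C := C) (k := k) (D := d ^ 3) hb hb' hb'₁, ?_⟩⟩
  · rintro (s | s)
    · exact hM s
    · change Finite (Alph K s)
      cases s <;> infer_instance
  set n := φ.numVars
  set m := φ.clauses.length with hm
  have hβ : m ≤ (encodeListWith encodeClause φ.clauses).length := by
    rw [hm]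
    generalize φ.clauses = Cs
    induction Cs with
    | nil => simp
    | cons C Cs ih =>
      rw [encodeListWith_cons]
      simp only [List.length_cons, List.length_append]
      omega
  have hopt := minUpTo_opt_restrict (d := d) hK hr φ hβ rfl
  refine outputsInTime ?_
  rw [← hopt]
  -- One bound `u` serves all runs, since all restricted instances have the same numbers of
  -- variables and constraints.
  refine computation hr φ rfl (u := ⌊C * b ^ (n / q + 1) * (((n / q + 1 : ℕ) : ℝ) + m + 1) ^ k⌋₊)
    (fun i _ => ?_) fun i _ => ?_
  · obtain ⟨t, ht, ⟨o⟩⟩ := h (restrict d q hr (digitList K (n / q + 1) i) φ)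
    refine ⟨⟨o.toEvalsTo, o.steps_le_m.trans (Nat.le_floor ?_)⟩⟩
    simpa [restrict] using ht
  · have h₁ := length_encode_le φ
    have h₂ := length_encode_restrict_le (d := d) (q := q) hr (digitList K (n / q + 1) i) φ
    have h₃ : (restrict (d := d) q hr (digitList K (n / q + 1) i) φ).opt ≤ m := by
      refine (minDeletions_le_length _ _).trans ?_
      simp [restrict, hm]
    have h₄ : n / q ≤ n := Nat.div_le_self _ _
    have h₅ : n + m + 1 ≤ (n + m + 1) ^ 2 := Nat.le_self_pow (by norm_num) _
    change φ.encode.length ≤ 10 * (n + m + 1) ^ 2 at h₁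
    change _ ≤ (12 + d ^ 3) * (n + m + 1) ^ 2 at h₂
    nlinarith

/-- A machine needs at least one step, so the basis of a valid time bound is positive. -/
theorem pos_of_maxCSPSolvable {d r : ℕ} {b : ℝ} (h : MaxCSPSolvable d r b) : 0 < b := by
  obtain ⟨M, _, C, k, h⟩ := h
  -- With exactly one variable the power is `b` itself, so `b ≤ 0` would leave no time for a single
  -- step.
  obtain ⟨t, ht, ⟨⟨⟨s, hs⟩, hst⟩⟩⟩ := h ⟨1, []⟩
  by_contra hb
  have ht0 : (t : ℝ) ≤ 0 := ht.trans (by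
    simp only [pow_one]
    exact mul_nonpos_of_nonpos_of_nonneg
      (mul_nonpos_of_nonneg_of_nonpos (by positivity) (not_lt.1 hb)) (by positivity))
  have ht1 : t = 0 := by exact_mod_cast le_antisymm ht0 (by positivity)
  have hs0 : s = 0 := by
    simp only at hst
    omega
  subst hs0
  exact Option.some_ne_none M.tm.main (Option.some.inj (congrArg (Option.map Cfg.l) hs))

end MinMachine

theorem SolvableInTime.mono {α : Type} {code : α → List Bool} {nVars nCons f : α → ℕ} {b b' : ℝ}
    (hb : 0 ≤ b) (hbb' : b ≤ b') (h : SolvableInTime code nVars nCons f b) :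
    SolvableInTime code nVars nCons f b' := by
  obtain ⟨M, hM, C, k, h⟩ := h
  refine ⟨M, hM, C, k, fun x => ?_⟩
  obtain ⟨t, ht, ho⟩ := h x
  exact ⟨t, ht.trans (by gcongr), ho⟩

open MinMachine in
theorem theorem2p2 (d r : ℕ) (hd : 2 ≤ d) (hr : 3 ≤ r) (hM3SH : MaxThreeSatHypothesis) :
    ¬ ∃ ε : ℝ, 0 < ε ∧ MaxCSPSolvable d r ((d : ℝ) - ε) := by
  rintro ⟨ε, hε, h⟩
  have hd' : (2 : ℝ) ≤ d := by exact_mod_cast hd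
  -- Shrinking `ε` to at most 1 makes the basis at least 1; monotonicity applies because a valid
  -- basis is positive.
  obtain ⟨δ, hδ, hδ1, h⟩ : ∃ δ : ℝ, 0 < δ ∧ δ ≤ 1 ∧ MaxCSPSolvable d r ((d : ℝ) - δ) :=
    ⟨min ε 1, by positivity, min_le_right _ _,
      h.mono (pos_of_maxCSPSolvable h).le (by linarith [min_le_left ε 1])⟩
  -- Equivalently `2 ^ q * δ / d > d`: the gain exceeds what rounding `2 ^ q / d` up can cost.
  obtain ⟨q, hq⟩ := pow_unbounded_of_one_lt ((d : ℝ) ^ 2 / δ) (one_lt_two (α := ℝ))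
  have hq0 : q ≠ 0 := by
    rintro rfl
    rw [pow_zero, div_lt_one hδ] at hq
    nlinarith
  have : NeZero d := ⟨by omega⟩
  have : NeZero q := ⟨hq0⟩
  set K := 2 ^ q / d + 1 with hK
  have : NeZero K := ⟨Nat.succ_ne_zero _⟩
  have hK2 : 2 ^ q ≤ K * d := ((Nat.div_lt_iff_lt_mul (NeZero.pos d)).1 (Nat.lt_succ_self _)).le
  have hb1 : (1 : ℝ) ≤ d - δ := by linarith
  have hK1 : (1 : ℝ) ≤ K := by exact_mod_cast NeZero.one_le
  have hlt : K * (d - δ) < (2 : ℝ) ^ q := by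
    have h₁ : (K : ℝ) ≤ 2 ^ q / d + 1 := by
      have := Nat.cast_div_le (α := ℝ) (m := 2 ^ q) (n := d)
      push_cast [hK] at this ⊢
      linarith
    have h₂ : (d : ℝ) < 2 ^ q / d * δ := by
      rw [div_lt_iff₀ hδ] at hq
      rw [div_mul_eq_mul_div, lt_div_iff₀ (by linarith)]
      linarith [sq (d : ℝ)]
    calc (K : ℝ) * (d - δ) ≤ (2 ^ q / d + 1) * (d - δ) := by gcongr
      _ = 2 ^ q / d * d - 2 ^ q / d * δ + (d - δ) := by ring
      _ < 2 ^ q := by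
        rw [div_mul_cancel₀ _ (by linarith)]
        linarith
  have h1 : 1 ≤ K * (d - δ) := one_le_mul_of_one_le_of_one_le hK1 hb1
  set b' : ℝ := (K * (d - δ)) ^ ((q : ℝ)⁻¹) with hb'
  have hpow : b' ^ q = K * (d - δ) := Real.rpow_inv_natCast_pow (by linarith) hq0
  have hb'0 : 0 ≤ b' := by positivity
  refine hM3SH ⟨2 - b', sub_pos.2 (lt_of_pow_lt_pow_left₀ q (by norm_num) (by rwa [hpow])), ?_⟩
  rw [sub_sub_cancel]
  exact maxThreeSatSolvable hr hK2 hb1 hpow.ge (Real.one_le_rpow h1 (by positivity)) h
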